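/- **Conventions.** Binary strings are identified with natural numbers by the length-increasing lexicographic correspondence $\epsilon\leftrightarrow 0,\ 0\leftrightarrow 1,\ 1\leftrightarrow 2,\ 00\leftrightarrow 3,\dots$; $l(p)$ is the length of $p$. A *prefix machine* is a partial recursive function $V(p,y)$ of a program $p$ and an auxiliary string $y$, with values in $\{0,1\}^*$, such that for every $y$ the set of $p$ on which $V(p,y)$ is defined is prefix-free. Fix a universal (reference) prefix machine $U$: for each prefix machine $V$ there is a string $s$ such that $U(sp,y)=V(p,y)$ for all $p,y$. Put $$K(x\mid y)=\min\{l(p):U(p,y)=x\},\qquad K(x)=K(x\mid\epsilon),$$ let $x^*$ be the first (in length-increasing lexicographic order) shortest program for $x$, i.e. the first $p$ with $U(p,\epsilon)=x$, and put $$I(x:y)=K(y)-K(y\mid x^*).$$ For a partial recursive function $f$ let $K(f)=\min\{K(i):\varphi_i \text{ computes } f\}$, where $\varphi_0,\varphi_1,\dots$ is a standard enumeration of the partial recursive functions. **Theorem.** There is a constant $c$ (depending only on $U$) such that for all strings $x,y,z$ and every program $q$ computing $z$ from $x^*$, i.e. $U(q,x^*)=z$, $$I(z:y) < I(x:y)+K(q)+c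 ,$$ and likewise $I(z:y)<I(x:y)+l(q)+c$. **Corollary.** There is a constant $c$ (depending only on $U$ and the enumeration $(\varphi_i)$) such that for all partial recursive functions $f,g$ and all strings $x,y$ such that $f(x)$ and $g(y)$ are defined (in particular for all $x,y$ if $f,g$ are total recursive), $$I(f(x):g(y)) < I(x:y)+K(f)+K(g)+c .$$ -/

import Mathlib

namespace AlgInfo

/-! ## Binary strings and natural numbers -/

/-- Binary strings, the elements of `{0,1}*`; `false` is the bit 0 and `true` is the bit 1. -/
abbrev Str : Type := List Bool

/-- The natural number of a binary string under the length-increasing lexicographic correspondence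
`(ε, 0), (0, 1), (1, 2), (00, 3), (01, 4), (10, 5), (11, 6), …`. -/
def strToNat (x : Str) : ℕ := x.foldl (fun n b => 2 * n + 1 + b.toNat) 0

/-- The binary string of a natural number, under the same correspondence. -/
def natToStr : ℕ → Str
  | 0 => []
  | n + 1 => natToStr (n / 2) ++ [decide (n % 2 = 1)]
decreasing_by omega

theorem strToNat_concat (x : Str) (b : Bool) :
    strToNat (x ++ [b]) = 2 * strToNat x + 1 + b.toNat := by
  simp [strToNat, List.foldl_append]

theorem strToNat_natToStr (n : ℕ) : strToNat (natToStr n) = n := by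
  induction n using Nat.strong_induction_on with
  | _ n ih =>
    cases n with
    | zero => simp [natToStr, strToNat]
    | succ n =>
      rw [natToStr, strToNat_concat, ih (n / 2) (by omega)]
      by_cases h : n % 2 = 1
      · simp [h]; omega
      · simp [h]; omega

theorem natToStr_strToNat (x : Str) : natToStr (strToNat x) = x := by
  induction x using List.reverseRecOn with
  | nil => simp [natToStr, strToNat]
  | append_singleton x b ih =>
    rw [strToNat_concat]
    cases b
    · have h1 : (2 * strToNat x) / 2 = strToNat x := by omega
      simp [natToStr, h1, ih]
    · have h1 : (2 * strToNat x + 1) / 2 = strToNat x := by omega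
      have h2 : (2 * strToNat x + 1) % 2 = 1 := by omega
      simp [natToStr, h1, h2, ih]

/-! ## Prefix machines -/

/-- A prefix machine with an auxiliary input: a partial recursive function `V` of a program `p` and
an auxiliary string `y` such that, for each `y`, the set of the programs on which `V` halts with
auxiliary input `y` is prefix-free. `V p y` is the result of the computation. -/
structure IsPrefixMachine (V : Str → Str →. Str) : Prop where
  partrec : Partrec₂ V
  prefixFree : ∀ y p p' : Str, (V p y).Dom → (V p' y).Dom → p <+: p' → p = p'

/-- A universal (reference) prefix machine: it is a prefix machine, and it simulates every prefix
machine `V` on programs that are preceded by a fixed string `s`, an index of `V`. -/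
structure IsReferenceMachine (U : Str → Str →. Str) : Prop extends IsPrefixMachine U where
  universal : ∀ V : Str → Str →. Str, IsPrefixMachine V → ∃ s : Str, ∀ p y : Str,
    U (s ++ p) y = V p y

/-! ## Prefix complexity -/

/-- The conditional prefix complexity `K(x | y)` with respect to the machine `U`: the least length
of a program `p` with `U(p, y) = x`. -/
noncomputable def condK (U : Str → Str →. Str) (x y : Str) : ℕ :=
  sInf {l : ℕ | ∃ p : Str, x ∈ U p y ∧ p.length = l}

/-- The prefix complexity `K(x) = K(x | ε)`. -/
noncomputable def K (U : Str → Str →. Str) (x : Str) : ℕ := condK U x []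

/-- `x*`, the first program for `x` in the length-increasing lexicographic order. -/
noncomputable def shortestProgram (U : Str → Str →. Str) (x : Str) : Str :=
  natToStr (sInf {n : ℕ | x ∈ U (natToStr n) []})

/-- The algorithmic mutual information `I(x : y) = K(y) - K(y | x*)`. -/
noncomputable def mutualInfo (U : Str → Str →. Str) (x y : Str) : ℤ :=
  (K U y : ℤ) - (condK U y (shortestProgram U x) : ℤ)

/-- The `i`-th partial recursive function `φ_i`, in the standard enumeration of all (codes of)
partial recursive functions. -/
def phi (i : ℕ) : ℕ →. ℕ := (Denumerable.ofNat Nat.Partrec.Code i).eval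

/-- `φ_i` computes `f`, when strings are identified with natural numbers. -/
def Computes (i : ℕ) (f : Str →. Str) : Prop :=
  ∀ x : Str, phi i (strToNat x) = (f x).map strToNat

/-- The complexity of a partial recursive function: `K(f) = min {K(i) : φ_i computes f}`. -/
noncomputable def funK (U : Str → Str →. Str) (f : Str →. Str) : ℕ :=
  sInf {k : ℕ | ∃ i : ℕ, Computes i f ∧ K U (natToStr i) = k}

/-! ## Reference machines exist -/

namespace Existence

open Nat.Partrec (Code)

/-- The self-delimiting code `1…10` (`i` ones) of the number `i`. -/
def header (i : ℕ) : Str := Nat.rec [false] (fun _ h => true :: h) i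

theorem header_prefix : ∀ (i j : ℕ) (r s : Str),
    header i ++ r <+: header j ++ s → i = j ∧ r <+: s
  | 0, 0, r, s, h => by simpa [header] using h
  | 0, j + 1, r, s, h => by simp [header] at h
  | i + 1, 0, r, s, h => by simp [header] at h
  | i + 1, j + 1, r, s, h => by
    have := header_prefix i j r s (by simpa [header] using h)
    simpa using this

/-- `m` codes a pair `(p', y)` with `p' ≠ p` comparable to `p`. -/
def Rival (p y : Str) (m : ℕ) : Prop :=
  ∃ w ∈ (Encodable.decode m : Option (Str × Str)), Encodable.encode w = m ∧
    w.2 = y ∧ w.1 ≠ p ∧ (p <+: w.1 ∨ w.1 <+: p)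

/-- `k` steps of the prefix machine that is obtained from the code `c`. -/
noncomputable def step (c : Code) (p y : Str) (k : ℕ) : Option Str :=
  open Classical in
  if ∀ m < k, ¬ (Rival p y m ∧ (Code.evaln k c m).isSome) then
    (Code.evaln k c (Encodable.encode (p, y))).bind Encodable.decode
  else none

theorem step_prefix {c : Code} {p p' y : Str} {k k' : ℕ}
    (h : (step c p y k).isSome) (h' : (step c p' y k').isSome) (hp : p <+: p') : p = p' := by
  have key : ∀ {p k}, (step c p y k).isSome →
      (∀ m < k, ¬ (Rival p y m ∧ (Code.evaln k c m).isSome)) ∧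
        (Code.evaln k c (Encodable.encode (p, y))).isSome := by
    intro p k h
    unfold step at h
    split_ifs at h with h1
    · refine ⟨h1, ?_⟩
      obtain ⟨v, hv⟩ := Option.isSome_iff_exists.1 h
      obtain ⟨n, hn, -⟩ := Option.bind_eq_some_iff.1 hv
      rw [hn]; rfl
    · simp at h
  by_contra hne
  have aux : ∀ {p p' k k'}, (step c p y k).isSome → (step c p' y k').isSome → p ≠ p' →
      (p <+: p' ∨ p' <+: p) → ¬ k ≤ k' := by
    intro p p' k k' h h' hne hc hk
    obtain ⟨v, hv⟩ := Option.isSome_iff_exists.1 (key h).2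
    have hv' := Code.evaln_mono hk hv
    refine (key h').1 _ (Code.evaln_bound hv') ⟨⟨(p, y), ?_, rfl, rfl, hne, hc.symm⟩, ?_⟩
    · exact Encodable.encodek _
    · rw [Option.mem_def.1 hv']; rfl
  rcases le_total k k' with hk | hk
  · exact aux h h' hne (Or.inl hp) hk
  · exact aux h' h (Ne.symm hne) (Or.inr hp) hk

theorem primrecPred_prefix {α : Type*} [Primcodable α] {f g : α → Str} (hf : Primrec f)
    (hg : Primrec g) : PrimrecPred fun a => f a <+: g a :=
  ((Primrec.eq.comp hf (Primrec.list_take.comp (Primrec.list_length.comp hf) hg))).of_eq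
    fun _ => (List.prefix_iff_eq_take).symm

theorem primrecPred_rival :
    PrimrecPred fun a : (Str × Str) × ℕ => Rival a.1.1 a.1.2 a.2 := by
  have h1 : PrimrecPred fun a : ((Str × Str) × ℕ) × (Str × Str) =>
      Encodable.encode a.2 = a.1.2 ∧ a.2.2 = a.1.1.2 ∧ a.2.1 ≠ a.1.1.1 ∧ (a.1.1.1 <+: a.2.1 ∨ a.2.1 <+: a.1.1.1) := by
    have e1 : Primrec fun a : ((Str × Str) × ℕ) × (Str × Str) => a.1.1.1 :=
      Primrec.fst.comp (Primrec.fst.comp Primrec.fst)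
    have e2 : Primrec fun a : ((Str × Str) × ℕ) × (Str × Str) => a.1.1.2 :=
      Primrec.snd.comp (Primrec.fst.comp Primrec.fst)
    have e3 : Primrec fun a : ((Str × Str) × ℕ) × (Str × Str) => a.2.1 :=
      Primrec.fst.comp Primrec.snd
    have e4 : Primrec fun a : ((Str × Str) × ℕ) × (Str × Str) => a.2.2 :=
      Primrec.snd.comp Primrec.snd
    exact (Primrec.eq.comp (Primrec.encode.comp Primrec.snd)
      (Primrec.snd.comp Primrec.fst)).and <| (Primrec.eq.comp e4 e2).and ((Primrec.eq.comp e3 e1).not.and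
      ((primrecPred_prefix e1 e3).or (primrecPred_prefix e3 e1)))
  classical
  obtain ⟨_, h1⟩ := h1
  have h2 : Primrec fun a : (Str × Str) × ℕ =>
      (Encodable.decode a.2 : Option (Str × Str)).map fun w =>
        decide (Encodable.encode w = a.2 ∧ w.2 = a.1.2 ∧ w.1 ≠ a.1.1 ∧ (a.1.1 <+: w.1 ∨ w.1 <+: a.1.1)) :=
    Primrec.option_map (Primrec.decode.comp Primrec.snd)
      (h1.of_eq fun _ => by congr)
  refine (Primrec.eq.comp h2 (Primrec.const (some true))).of_eq fun a => ?_
  simp only [Option.map_eq_some_iff, decide_eq_true_eq, Rival, Option.mem_def]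

theorem primrec_step :
    Primrec fun a : (Code × Str × Str) × ℕ => step a.1.1 a.1.2.1 a.1.2.2 a.2 := by
  classical
  have ev : Primrec fun b : ℕ × ((Code × Str × Str) × ℕ) => Code.evaln b.2.2 b.2.1.1 b.1 :=
    Code.primrec_evaln.comp (((Primrec.snd.comp Primrec.snd).pair
      (Primrec.fst.comp (Primrec.fst.comp Primrec.snd))).pair Primrec.fst)
  have h1 : PrimrecRel fun (m : ℕ) (a : (Code × Str × Str) × ℕ) =>
      ¬ (Rival a.1.2.1 a.1.2.2 m ∧ (Code.evaln a.2 a.1.1 m).isSome) := by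
    refine PrimrecPred.not (PrimrecPred.and ?_ ?_)
    · exact primrecPred_rival.comp
        ((Primrec.snd.comp (Primrec.fst.comp Primrec.snd)).pair Primrec.fst)
    · exact (Primrec.eq.comp (Primrec.option_isSome.comp ev) (Primrec.const true))
  have h2 : PrimrecPred fun a : (Code × Str × Str) × ℕ =>
      ∀ m < a.2, ¬ (Rival a.1.2.1 a.1.2.2 m ∧ (Code.evaln a.2 a.1.1 m).isSome) := by
    refine ((PrimrecRel.forall_mem_list h1).comp
      (Primrec.list_range.comp Primrec.snd) Primrec.id).of_eq fun a => ?_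
    simp only [List.mem_range, id]
  have h3 : Primrec fun a : (Code × Str × Str) × ℕ =>
      (Code.evaln a.2 a.1.1 (Encodable.encode a.1.2)).bind
        (Encodable.decode : ℕ → Option Str) :=
    Primrec.option_bind
      (Code.primrec_evaln.comp ((Primrec.snd.pair (Primrec.fst.comp Primrec.fst)).pair
        (Primrec.encode.comp (Primrec.snd.comp Primrec.fst))))
      (Primrec.decode.comp Primrec.snd)
  refine (Primrec.ite h2 h3 (Primrec.const none)).of_eq fun a => ?_
  simp only [step]

/-- One stage `k = (i, r, j)` of the computation of the universal machine. -/
noncomputable def stage (p y : Str) (k : ℕ × Str × ℕ) : Option Str :=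
  if header k.1 ++ k.2.1 = p then step (Denumerable.ofNat Code k.1) k.2.1 y k.2.2 else none

theorem primrec_stage :
    Primrec fun a : (Str × Str) × (ℕ × Str × ℕ) => stage a.1.1 a.1.2 a.2 := by
  have hh : Primrec header :=
    (Primrec.nat_rec₁ [false] ((Primrec.list_cons.comp (Primrec.const true) Primrec.snd).to₂)).of_eq
      fun n => rfl
  have e1 : Primrec fun a : (Str × Str) × (ℕ × Str × ℕ) => a.2.1 := Primrec.fst.comp Primrec.snd
  have e2 : Primrec fun a : (Str × Str) × (ℕ × Str × ℕ) => a.2.2.1 :=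
    Primrec.fst.comp (Primrec.snd.comp Primrec.snd)
  have e3 : Primrec fun a : (Str × Str) × (ℕ × Str × ℕ) => a.2.2.2 :=
    Primrec.snd.comp (Primrec.snd.comp Primrec.snd)
  refine Primrec.ite
    (Primrec.eq.comp (Primrec.list_append.comp (hh.comp e1) e2) (Primrec.fst.comp Primrec.fst)) ?_
    (Primrec.const none)
  exact primrec_step.comp ((((Primrec.ofNat Code).comp e1).pair
    (e2.pair (Primrec.snd.comp Primrec.fst))).pair e3)

theorem exists_isReferenceMachine : ∃ U, IsReferenceMachine U := by
  let G : Str × Str → ℕ → Option Str := fun a k =>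
    (Encodable.decode k : Option (ℕ × Str × ℕ)).bind (stage a.1 a.2)
  have hG : Computable₂ G := by
    refine Primrec.to_comp ?_
    exact Primrec.option_bind (Primrec.decode.comp Primrec.snd)
      (primrec_stage.comp ((Primrec.fst.comp Primrec.fst).pair Primrec.snd))
  have mem : ∀ {p y v}, v ∈ Nat.rfindOpt (G (p, y)) →
      ∃ i r j, header i ++ r = p ∧ v ∈ step (Denumerable.ofNat Code i) r y j := by
    intro p y v h
    obtain ⟨k, hk⟩ := Nat.rfindOpt_spec h
    simp only [G, Option.mem_def, Option.bind_eq_some_iff] at hk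
    obtain ⟨⟨i, r, j⟩, -, hk⟩ := hk
    unfold stage at hk
    split_ifs at hk with h1
    exact ⟨i, r, j, h1, hk⟩
  refine ⟨fun p y => Nat.rfindOpt (G (p, y)), ⟨?_, ?_⟩, ?_⟩
  · exact Partrec.rfindOpt hG
  · intro y p p' h h' hp
    obtain ⟨i, r, j, rfl, hs⟩ := mem (Part.get_mem h)
    obtain ⟨i', r', j', rfl, hs'⟩ := mem (Part.get_mem h')
    obtain ⟨rfl, hr⟩ := header_prefix _ _ _ _ hp
    rw [step_prefix (Option.isSome_of_mem hs) (Option.isSome_of_mem hs') hr]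
  · intro V hV
    obtain ⟨c, hc⟩ := Code.exists_code.1 hV.partrec
    have hc' : ∀ p y, c.eval (Encodable.encode (p, y)) = (V p y).map Encodable.encode := by
      intro p y
      rw [hc]
      simp
    have out : ∀ {k p y n}, n ∈ Code.evaln k c (Encodable.encode (p, y)) →
        ∃ v ∈ V p y, Encodable.encode v = n := by
      intro k p y n h
      have := Code.evaln_sound h
      rw [hc'] at this
      simpa using this
    have hstep : ∀ r y j v, v ∈ step c r y j ↔
        Encodable.encode v ∈ Code.evaln j c (Encodable.encode (r, y)) := by
      intro r y j v
      constructor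
      · intro h
        unfold step at h
        split_ifs at h
        · simp only [Option.mem_def, Option.bind_eq_some_iff] at h
          obtain ⟨n, hn, hv⟩ := h
          obtain ⟨w, -, rfl⟩ := out hn
          simp only [Encodable.encodek, Option.some.injEq] at hv
          subst hv
          exact hn
        · simp at h
      · intro h
        unfold step
        rw [if_pos]
        · rw [Option.mem_def.1 h]
          exact Encodable.encodek v
        · rintro m - ⟨⟨⟨p', y'⟩, -, rfl, rfl, hne, hcmp⟩, hs⟩
          obtain ⟨n, hn⟩ := Option.isSome_iff_exists.1 hs
          obtain ⟨v', hv', -⟩ := out hn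
          obtain ⟨w, hw, -⟩ := out h
          have d' := Part.dom_iff_mem.2 ⟨v', hv'⟩
          have d := Part.dom_iff_mem.2 ⟨w, hw⟩
          rcases hcmp with hcmp | hcmp
          · exact hne (hV.prefixFree _ _ _ d d' hcmp).symm
          · exact hne (hV.prefixFree _ _ _ d' d hcmp)
    refine ⟨header (Encodable.encode c), fun p y => ?_⟩
    have sub : ∀ v, v ∈ Nat.rfindOpt (G (header (Encodable.encode c) ++ p, y)) → v ∈ V p y := by
      intro v h
      obtain ⟨i, r, j, he, hs⟩ := mem h
      obtain ⟨rfl, -⟩ := header_prefix i (Encodable.encode c) r p (by rw [he])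
      have hr := List.append_cancel_left he
      subst hr
      rw [Denumerable.ofNat_encode, hstep] at hs
      obtain ⟨w, hw, hwv⟩ := out hs
      rwa [← Encodable.encode_injective hwv]
    refine Part.ext fun v => ⟨sub v, fun hv => ?_⟩
    have h1 : Encodable.encode v ∈ c.eval (Encodable.encode (p, y)) := by
      rw [hc']
      exact Part.mem_map _ hv
    obtain ⟨j, hj⟩ := Code.evaln_complete.1 h1
    have h2 : (Nat.rfindOpt (G (header (Encodable.encode c) ++ p, y))).Dom := by
      refine Nat.rfindOpt_dom.2 ⟨Encodable.encode (Encodable.encode c, p, j), v, ?_⟩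
      simp only [G, Encodable.encodek, Option.bind_some, stage, if_true, Denumerable.ofNat_encode]
      exact (hstep _ _ _ _).2 hj
    have h3 := Part.get_mem h2
    rwa [Part.mem_unique (sub _ h3) hv] at h3

end Existence

/-! ## The minima above are attained -/

theorem length_bounds (x : Str) :
    2 ^ x.length ≤ strToNat x + 1 ∧ strToNat x + 1 < 2 ^ (x.length + 1) := by
  induction x using List.reverseRecOn with
  | nil => simp [strToNat]
  | append_singleton x b ih =>
    rw [strToNat_concat]
    cases b <;> simp [pow_succ] at ih ⊢ <;> omega

theorem length_mono {x y : Str} (h : strToNat x ≤ strToNat y) : x.length ≤ y.length := by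
  by_contra hlt
  have h1 := (length_bounds x).1
  have h2 := (length_bounds y).2
  have h3 : 2 ^ (y.length + 1) ≤ 2 ^ x.length := Nat.pow_le_pow_right (by norm_num) (by omega)
  omega

theorem IsReferenceMachine.exists_program {U : Str → Str →. Str} (hU : IsReferenceMachine U)
    (x y : Str) : ∃ p, x ∈ U p y := by
  obtain ⟨s, hs⟩ := hU.universal (fun p _ => if p = [] then Part.some x else Part.none) ⟨by
    have h : Partrec (fun a : Str × Str =>
      ((if a.1 = [] then some x else none : Option Str) : Part Str)) :=
      Computable.ofOption (Primrec.to_comp (Primrec.ite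
        (Primrec.eq.comp Primrec.fst (Primrec.const [])) (Primrec.const (some x))
        (Primrec.const none)))
    refine Partrec.of_eq h fun a => ?_
    by_cases ha : a.1 = [] <;> simp [ha], by
    intro y p p' h h' _
    split_ifs at h h' with h1 h2
    · rw [h1, h2]
    · exact h'.elim
    · exact h.elim
    · exact h.elim⟩
  exact ⟨s, by have := hs [] y; simp at this; simp [this]⟩

/-- `x*` is a program for `x`, and its length is `K(x)`. -/
theorem IsReferenceMachine.shortestProgram_spec {U : Str → Str →. Str}
    (hU : IsReferenceMachine U) (x : Str) :
    x ∈ U (shortestProgram U x) [] ∧ (shortestProgram U x).length = K U x := by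
  have hex := hU.exists_program x []
  have hne : {n : ℕ | x ∈ U (natToStr n) []}.Nonempty := by
    obtain ⟨p, hp⟩ := hex
    exact ⟨strToNat p, by simpa [natToStr_strToNat] using hp⟩
  have hmem : x ∈ U (shortestProgram U x) [] := Nat.sInf_mem hne
  refine ⟨hmem, le_antisymm ?_ (Nat.sInf_le ⟨_, hmem, rfl⟩)⟩
  have hne2 : {l : ℕ | ∃ p : Str, x ∈ U p [] ∧ p.length = l}.Nonempty := by
    obtain ⟨p, hp⟩ := hex
    exact ⟨_, p, hp, rfl⟩
  obtain ⟨p, hp, hl⟩ := Nat.sInf_mem hne2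
  rw [K, condK, ← hl]
  apply length_mono
  rw [shortestProgram, strToNat_natToStr]
  exact Nat.sInf_le (by simpa [natToStr_strToNat] using hp)

theorem exists_computes {f : Str →. Str} (hf : Partrec f) : ∃ i, Computes i f := by
  have h1 : Primrec strToNat := by
    have hs : Primrec₂ fun (_ : Str) (w : ℕ × Bool) => 2 * w.1 + 1 + w.2.toNat :=
      Primrec.nat_add.comp (Primrec.succ.comp (Primrec.nat_mul.comp (Primrec.const 2)
        (Primrec.fst.comp Primrec.snd)))
        ((Primrec.dom_finite Bool.toNat).comp (Primrec.snd.comp Primrec.snd))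
    exact Primrec.list_foldl Primrec.id (Primrec.const 0) hs
  let g : ℕ → ℕ → Option Str := fun n k =>
    (Encodable.decode k : Option Str).bind fun x => if strToNat x = n then some x else none
  have h2 : Partrec fun n : ℕ => Nat.rfindOpt (g n) := by
    refine Partrec.rfindOpt (Primrec.to_comp ?_)
    refine Primrec.option_bind (Primrec.decode.comp Primrec.snd) ?_
    exact Primrec.ite (Primrec.eq.comp (h1.comp Primrec.snd) (Primrec.fst.comp Primrec.fst))
      (Primrec.option_some.comp Primrec.snd) (Primrec.const none)
  have h3 : ∀ x, Nat.rfindOpt (g (strToNat x)) = Part.some x := by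
    intro x
    have hd : (Nat.rfindOpt (g (strToNat x))).Dom :=
      Nat.rfindOpt_dom.2 ⟨Encodable.encode x, x, by simp [g]⟩
    have hm := Part.get_mem hd
    obtain ⟨k, hk⟩ := Nat.rfindOpt_spec hm
    simp only [g, Option.mem_def, Option.bind_eq_some_iff, Option.ite_none_right_eq_some,
      Option.some.injEq] at hk
    obtain ⟨w, -, hw, he⟩ := hk
    have : w = x := by rw [← natToStr_strToNat w, hw, natToStr_strToNat]
    rw [Part.eq_some_iff]
    rwa [← he, this] at hm
  have h4 : Partrec fun n : ℕ => ((Nat.rfindOpt (g n)).bind f).map strToNat :=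
    (h2.bind (hf.comp Computable.snd).to₂).map (h1.to_comp.comp Computable.snd).to₂
  obtain ⟨c, hc⟩ := Nat.Partrec.Code.exists_code.1 (Partrec.nat_iff.1 h4)
  refine ⟨Encodable.encode c, fun x => ?_⟩
  rw [phi, Denumerable.ofNat_encode, hc]
  change ((Nat.rfindOpt (g (strToNat x))).bind (f : Str → Part Str)).map strToNat = _
  rw [h3]
  exact congrArg (Part.map strToNat) (Part.bind_some x f)

end AlgInfo

/-!
The inequality `I(z : y) ≤ I(x : y) + l(q) + O(1)` says `K(y | x*) ≤ K(y | z*) + l(q) + O(1)`. It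
cannot be proved by composing programs, because `z*` cannot be computed from `z`. It follows instead
from the symmetry of information, whose hard direction is `exists_K_add_condK_le`: if `p` is a
program of a prefix machine for the pair `(x, y)`, then `K(x) + K(y | x*) ≤ l(p) + O(1)`. Applied to
concatenated programs, it gives
* `K(x) + K(y | x*) ≤ K(z) + K(x | z*) + K(y | z*) + O(1)` (from `z*` one gets both `x` and `y`);
* `K(z) + K(x | z*) ≤ K(x) + l(q) + O(1)` (the string `x* q` describes `(z, x)`), and the same with
  `K(q)` in place of `l(q)`.

The sum of the two is the claim. With a shortest `q` the second one also gives
`I(x : z) ≤ I(z : x) + O(1)`. For the corollary, a shortest program of an index of `f` yields a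
program of length `K(f) + O(1)` that computes `f(x)` from `x*`, and the theorem is applied once in
each argument.

The hard direction rests on two applications of Kraft–Chaitin coding (`kraft_chaitin`). The first
one is the coding theorem (`coding_theorem`): the programs for pairs `(x, ·)` have total weight at
most `2 ^ (c - K(x))`. Therefore, given `x*`, which determines `x` and `K(x)`, codewords of length
`l(p) + c - K(x)` can be requested for the strings `y` for which a program `p` for `(x, y)` is found,
which is the second one. Kraft–Chaitin coding is allowed to lose one bit here, so no bookkeeping of
free intervals is needed: the `n`-th request gets the interval of length `2 ^ (-l)` that follows the
earlier ones, and any dyadic interval of half that length inside it serves as a codeword. All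
machines are specified by semidecidable graphs (`SemiDecidable`), so that computability reduces to
closure properties.
-/

namespace AlgInfo

open scoped ENNReal

/-! ### Semidecidable predicates -/

theorem primrecPred_exists_lt {α β : Type*} [Primcodable α] [Primcodable β] {q : β → ℕ → Prop}
    (hq : PrimrecRel q) {f : α → β} {g : α → ℕ} (hf : Primrec f) (hg : Primrec g) :
    PrimrecPred fun a => ∃ m < g a, q (f a) m := by
  have h : PrimrecRel fun (m : ℕ) (b : β) => q b m := PrimrecRel.comp hq Primrec.snd Primrec.fst
  exact (PrimrecRel.comp (PrimrecRel.exists_mem_list h) (Primrec.list_range.comp hg) hf).of_eq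
    fun a => by simp only [List.mem_range]

theorem primrecPred_forall_lt {α β : Type*} [Primcodable α] [Primcodable β] {q : β → ℕ → Prop}
    (hq : PrimrecRel q) {f : α → β} {g : α → ℕ} (hf : Primrec f) (hg : Primrec g) :
    PrimrecPred fun a => ∀ m < g a, q (f a) m := by
  have h : PrimrecRel fun (m : ℕ) (b : β) => q b m := PrimrecRel.comp hq Primrec.snd Primrec.fst
  exact (PrimrecRel.comp (PrimrecRel.forall_mem_list h) (Primrec.list_range.comp hg) hf).of_eq
    fun a => by simp only [List.mem_range]

/-- A semidecidable (recursively enumerable, `Σ₁`) predicate, in Kleene normal form: the projection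
of a primitive recursive relation along a natural number, the stage at which membership is
discovered. -/
def SemiDecidable {α : Type*} [Primcodable α] (P : α → Prop) : Prop :=
  ∃ q : α → ℕ → Prop, PrimrecRel q ∧ ∀ a, P a ↔ ∃ n, q a n

namespace SemiDecidable

variable {α β γ : Type*} [Primcodable α] [Primcodable β] [Primcodable γ]

theorem of_eq {P Q : α → Prop} (hP : SemiDecidable P) (h : ∀ a, P a ↔ Q a) : SemiDecidable Q := by
  rwa [← funext fun a => propext (h a)]

theorem of_primrecPred {P : α → Prop} (hP : PrimrecPred P) : SemiDecidable P :=
  ⟨fun a _ => P a, hP.comp Primrec.fst, fun _ => ⟨fun h => ⟨0, h⟩, fun ⟨_, h⟩ => h⟩⟩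

theorem comp {P : β → Prop} (hP : SemiDecidable P) {f : α → β} (hf : Primrec f) :
    SemiDecidable fun a => P (f a) := by
  obtain ⟨q, hq, h⟩ := hP
  exact ⟨fun a n => q (f a) n, PrimrecRel.comp hq (hf.comp Primrec.fst) Primrec.snd,
    fun a => h (f a)⟩

theorem exists_nat_primrec {q : α → β → ℕ → Prop}
    (hq : PrimrecPred fun a : α × β × ℕ => q a.1 a.2.1 a.2.2) :
    SemiDecidable fun a => ∃ b n, q a b n := by
  classical
  obtain ⟨_, hq⟩ := hq
  have h2 : Primrec fun a : α × ℕ => (Encodable.decode a.2 : Option (β × ℕ)).map fun w =>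
      decide (q a.1 w.1 w.2) :=
    Primrec.option_map (Primrec.decode.comp Primrec.snd)
      ((hq.comp ((Primrec.fst.comp Primrec.fst).pair Primrec.snd)).of_eq fun _ => by congr)
  refine ⟨fun a n => (Encodable.decode n : Option (β × ℕ)).map (fun w =>
      decide (q a w.1 w.2)) = some true, Primrec.eq.comp h2 (Primrec.const (some true)), fun a => ?_⟩
  simp only [Option.map_eq_some_iff, decide_eq_true_eq]
  constructor
  · rintro ⟨b, n, h⟩
    exact ⟨Encodable.encode (b, n), (b, n), Encodable.encodek _, h⟩
  · rintro ⟨-, ⟨b, n⟩, -, h⟩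
    exact ⟨b, n, h⟩

theorem exists_right {P : α → β → Prop} (hP : SemiDecidable fun a : α × β => P a.1 a.2) :
    SemiDecidable fun a => ∃ b, P a b := by
  obtain ⟨q, hq, h⟩ := hP
  refine (exists_nat_primrec (q := fun a b n => q (a, b) n) ?_).of_eq
    fun a => exists_congr fun b => (h (a, b)).symm
  exact PrimrecRel.comp hq (Primrec.fst.pair (Primrec.fst.comp Primrec.snd))
    (Primrec.snd.comp Primrec.snd)

theorem and {P Q : α → Prop} (hP : SemiDecidable P) (hQ : SemiDecidable Q) :
    SemiDecidable fun a => P a ∧ Q a := by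
  obtain ⟨q, hq, h⟩ := hP
  obtain ⟨r, hr, h'⟩ := hQ
  refine (exists_nat_primrec (β := ℕ) (q := fun a b n => q a b ∧ r a n) ?_).of_eq fun a => ?_
  · exact (PrimrecRel.comp hq Primrec.fst (Primrec.fst.comp Primrec.snd)).and
      (PrimrecRel.comp hr Primrec.fst (Primrec.snd.comp Primrec.snd))
  · rw [h, h']
    exact exists_and_exists_comm.symm

theorem forall_mem_list {P : β → α → Prop} (hP : SemiDecidable fun a : β × α => P a.1 a.2) :
    SemiDecidable fun a : List β × α => ∀ b ∈ a.1, P b a.2 := by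
  obtain ⟨q, hq, h⟩ := hP
  have h2 : PrimrecRel fun (b : β) (w : α × ℕ) => ∃ m < w.2, q (b, w.1) m :=
    primrecPred_exists_lt hq (Primrec.fst.pair (Primrec.fst.comp Primrec.snd))
      (Primrec.snd.comp Primrec.snd)
  refine ⟨fun a n => ∀ b ∈ a.1, ∃ m < n, q (b, a.2) m,
    (PrimrecRel.forall_mem_list h2).comp (Primrec.fst.comp Primrec.fst)
      ((Primrec.snd.comp Primrec.fst).pair Primrec.snd), ?_⟩
  rintro ⟨L, a⟩
  constructor
  · intro hL
    have : ∀ b, ∃ m, b ∈ L → q (b, a) m := fun b => by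
      by_cases hb : b ∈ L
      · obtain ⟨m, hm⟩ := (h (b, a)).1 (hL b hb)
        exact ⟨m, fun _ => hm⟩
      · exact ⟨0, fun h => absurd h hb⟩
    choose m hm using this
    refine ⟨(L.map m).sum + 1, fun b hb => ⟨m b, ?_, hm b hb⟩⟩
    exact Nat.lt_succ_of_le (List.le_sum_of_mem (List.mem_map_of_mem hb))
  · rintro ⟨n, hn⟩ b hb
    obtain ⟨m, -, hm⟩ := hn b hb
    exact (h (b, a)).2 ⟨m, hm⟩

theorem graph {f : α →. β} (hf : Partrec f) : SemiDecidable fun a : α × β => a.2 ∈ f a.1 := by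
  obtain ⟨c, hc⟩ := Nat.Partrec.Code.exists_code.1 hf
  have hc' : ∀ a, c.eval (Encodable.encode a) = (f a).map Encodable.encode := by
    intro a
    rw [hc]
    simp
  refine ⟨fun a n => c.evaln n (Encodable.encode a.1) = some (Encodable.encode a.2), ?_, ?_⟩
  · exact Primrec.eq.comp (Nat.Partrec.Code.primrec_evaln.comp
      ((Primrec.snd.pair (Primrec.const c)).pair
        (Primrec.encode.comp (Primrec.fst.comp Primrec.fst))))
      (Primrec.option_some.comp (Primrec.encode.comp (Primrec.snd.comp Primrec.fst)))
  · rintro ⟨a, b⟩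
    have := (Nat.Partrec.Code.evaln_complete (c := c) (n := Encodable.encode a)
      (x := Encodable.encode b))
    simp only [Option.mem_def] at this
    rw [← this, hc']
    simp

/-- A single-valued relation with a semidecidable graph is the graph of a partial recursive
function. -/
theorem exists_partrec {P : α → β → Prop} (hP : SemiDecidable fun a : α × β => P a.1 a.2)
    (huniq : ∀ a b b', P a b → P a b' → b = b') :
    ∃ f : α →. β, Partrec f ∧ ∀ a b, b ∈ f a ↔ P a b := by
  classical
  obtain ⟨q, hq, h⟩ := hP
  let G : α → ℕ → Option β := fun a n => (Encodable.decode n : Option (β × ℕ)).bind fun w =>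
    if q (a, w.1) w.2 then some w.1 else none
  have hG : Computable₂ G := by
    refine Primrec.to_comp (Primrec.option_bind (Primrec.decode.comp Primrec.snd) ?_)
    refine Primrec.ite (PrimrecRel.comp hq ?_ ?_) (Primrec.option_some.comp
      (Primrec.fst.comp Primrec.snd)) (Primrec.const none)
    · exact (Primrec.fst.comp Primrec.fst).pair (Primrec.fst.comp Primrec.snd)
    · exact Primrec.snd.comp Primrec.snd
  have hmem : ∀ {a n b}, b ∈ G a n → P a b := by
    intro a n b hb
    simp only [G, Option.mem_def, Option.bind_eq_some_iff, Option.ite_none_right_eq_some,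
      Option.some.injEq] at hb
    obtain ⟨w, -, hw, rfl⟩ := hb
    exact (h (a, w.1)).2 ⟨_, hw⟩
  refine ⟨fun a => Nat.rfindOpt (G a), Partrec.rfindOpt hG, fun a b => ⟨fun hb => ?_, fun hb => ?_⟩⟩
  · obtain ⟨n, hn⟩ := Nat.rfindOpt_spec hb
    exact hmem hn
  · obtain ⟨n, hn⟩ := (h (a, b)).1 hb
    have hd : (Nat.rfindOpt (G a)).Dom :=
      Nat.rfindOpt_dom.2 ⟨Encodable.encode (b, n), b, by
        simp only [G, Encodable.encodek, Option.bind_some, if_pos hn, Option.mem_def]⟩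
    obtain ⟨m, hm⟩ := Nat.rfindOpt_spec (Part.get_mem hd)
    have := Part.get_mem hd
    rwa [huniq a _ b (hmem hm) hb] at this

/-- The elements related to `a` by a semidecidable relation can be enumerated without repetitions,
primitive recursively in `a` and the stage. A stage may be idle (`none`). -/
theorem exists_enumeration {P : α → β → Prop} (hP : SemiDecidable fun a : α × β => P a.1 a.2) :
    ∃ e : α → ℕ → Option β, Primrec₂ e ∧ (∀ a n b, b ∈ e a n → P a b) ∧
      (∀ a b, P a b → ∃ n, b ∈ e a n) ∧ ∀ a b n n', b ∈ e a n → b ∈ e a n' → n = n' := by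
  classical
  obtain ⟨q, hq, h⟩ := hP
  let C : α → ℕ → β × ℕ → Prop := fun a n w =>
    Encodable.encode w = n ∧ q (a, w.1) w.2 ∧ ∀ m < w.2, ¬ q (a, w.1) m
  have hC : PrimrecPred fun a : (α × ℕ) × (β × ℕ) => C a.1.1 a.1.2 a.2 := by
    have e1 : Primrec fun a : (α × ℕ) × (β × ℕ) => (a.1.1, a.2.1) :=
      (Primrec.fst.comp Primrec.fst).pair (Primrec.fst.comp Primrec.snd)
    have e2 : Primrec fun a : (α × ℕ) × (β × ℕ) => a.2.2 := Primrec.snd.comp Primrec.snd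
    have h1 : PrimrecRel fun (w : α × β) (m : ℕ) => ¬ q w m :=
      PrimrecPred.not (PrimrecRel.comp hq Primrec.fst Primrec.snd)
    exact (Primrec.eq.comp (Primrec.encode.comp Primrec.snd) (Primrec.snd.comp Primrec.fst)).and
      ((PrimrecRel.comp hq e1 e2).and (primrecPred_forall_lt h1 e1 e2))
  have hmem : ∀ a n b, b ∈ (Encodable.decode n : Option (β × ℕ)).bind (fun w =>
      if C a n w then some w.1 else none) ↔ ∃ m, C a n (b, m) := by
    intro a n b
    simp only [Option.mem_def, Option.bind_eq_some_iff, Option.ite_none_right_eq_some,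
      Option.some.injEq]
    constructor
    · rintro ⟨⟨b, m⟩, -, hw, rfl⟩
      exact ⟨m, hw⟩
    · rintro ⟨m, hm⟩
      refine ⟨(b, m), ?_, hm, rfl⟩
      rw [← hm.1, Encodable.encodek]
  refine ⟨fun a n => (Encodable.decode n : Option (β × ℕ)).bind fun w =>
    if C a n w then some w.1 else none, ?_, fun a n b hb => ?_, fun a b hb => ?_,
    fun a b n n' hn hn' => ?_⟩
  · refine Primrec.option_bind (Primrec.decode.comp Primrec.snd) ?_
    exact Primrec.ite hC (Primrec.option_some.comp (Primrec.fst.comp Primrec.snd))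
      (Primrec.const none)
  · obtain ⟨m, hm⟩ := (hmem a n b).1 hb
    exact (h (a, b)).2 ⟨m, hm.2.1⟩
  · have hex := (h (a, b)).1 hb
    exact ⟨_, (hmem a _ b).2 ⟨Nat.find hex, rfl, Nat.find_spec hex, fun m => Nat.find_min hex⟩⟩
  · obtain ⟨m, rfl, hm, hmin⟩ := (hmem a n b).1 hn
    obtain ⟨m', rfl, hm', hmin'⟩ := (hmem a n' b).1 hn'
    have : m = m' := le_antisymm (not_lt.1 fun hlt => hmin _ hlt hm')
      (not_lt.1 fun hlt => hmin' _ hlt hm)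
    rw [this]

end SemiDecidable

/-! ### Dyadic intervals and Kraft's inequality -/

theorem strToNat_injective : Function.Injective strToNat :=
  Function.LeftInverse.injective natToStr_strToNat

/-- The dyadic interval of a string `p`: the numbers in `[1, 2)` whose binary expansion is `1.p…`.
The integer with the binary digits `1p` is `strToNat p + 1`. -/
def cell (p : Str) : Set ℝ :=
  Set.Ico (((strToNat p : ℝ) + 1) / 2 ^ p.length) (((strToNat p : ℝ) + 2) / 2 ^ p.length)

theorem cell_append_subset (p r : Str) : cell (p ++ r) ⊆ cell p := by
  induction r using List.reverseRecOn with
  | nil => simp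
  | append_singleton r b ih =>
    refine Set.Subset.trans ?_ ih
    rw [← List.append_assoc]
    generalize p ++ r = w
    have hb : (0 : ℝ) ≤ (b.toNat : ℝ) ∧ (b.toNat : ℝ) ≤ 1 := by cases b <;> simp
    rw [cell, cell, strToNat_concat, List.length_append, List.length_singleton, pow_succ]
    push_cast
    apply Set.Ico_subset_Ico
    · rw [div_le_div_iff₀ (by positivity) (by positivity)]
      nlinarith [hb.1, pow_pos (two_pos : (0 : ℝ) < 2) w.length]
    · rw [div_le_div_iff₀ (by positivity) (by positivity)]
      nlinarith [hb.2, pow_pos (two_pos : (0 : ℝ) < 2) w.length]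

theorem cell_subset_of_prefix {p p' : Str} (h : p <+: p') : cell p' ⊆ cell p := by
  obtain ⟨r, rfl⟩ := h
  exact cell_append_subset p r

theorem cell_subset_Ico (p : Str) : cell p ⊆ Set.Ico 1 2 := by
  simpa [cell, strToNat] using cell_append_subset [] p

theorem eq_of_length_eq_of_mem_cell {p p' : Str} (hl : p.length = p'.length) {t : ℝ}
    (h : t ∈ cell p) (h' : t ∈ cell p') : p = p' := by
  have h2 : (0 : ℝ) < 2 ^ p'.length := by positivity
  rw [cell, Set.mem_Ico, div_le_iff₀ (by positivity), lt_div_iff₀ (by positivity)] at h h'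
  rw [hl] at h
  apply strToNat_injective
  have h3 : (strToNat p : ℝ) < strToNat p' + 1 := by linarith
  have h4 : (strToNat p' : ℝ) < strToNat p + 1 := by linarith
  norm_cast at h3 h4
  omega

theorem prefix_or_prefix_of_mem_cell {p p' : Str} {t : ℝ} (h : t ∈ cell p) (h' : t ∈ cell p') :
    p <+: p' ∨ p' <+: p := by
  have aux : ∀ {p p' : Str}, t ∈ cell p → t ∈ cell p' → p.length ≤ p'.length → p <+: p' := by
    intro p p' h h' hl
    have h1 := cell_subset_of_prefix (List.take_prefix p.length p') h'
    have h2 : p = p'.take p.length :=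
      eq_of_length_eq_of_mem_cell (by rw [List.length_take, min_eq_left hl]) h h1
    rw [h2]
    exact List.take_prefix _ _
  rcases le_total p.length p'.length with hl | hl
  · exact Or.inl (aux h h' hl)
  · exact Or.inr (aux h' h hl)

theorem left_mem_cell (p : Str) : ((strToNat p : ℝ) + 1) / 2 ^ p.length ∈ cell p := by
  refine ⟨le_rfl, ?_⟩
  gcongr
  norm_num

theorem ofReal_inv_two_pow (n : ℕ) : ENNReal.ofReal ((2 ^ n)⁻¹) = (2⁻¹ : ℝ≥0∞) ^ n := by
  rw [ENNReal.ofReal_inv_of_pos (by positivity), ENNReal.ofReal_pow (by norm_num),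
    ENNReal.ofReal_ofNat, ENNReal.inv_pow]

theorem volume_cell (p : Str) : MeasureTheory.volume (cell p) = (2⁻¹ : ℝ≥0∞) ^ p.length := by
  rw [cell, Real.volume_Ico, ← ofReal_inv_two_pow]
  congr 1
  ring

/-- **Kraft's inequality** for prefix-free sets of strings. -/
theorem kraft_inequality {P : Str → Prop} (hP : ∀ p p', P p → P p' → p <+: p' → p = p') :
    ∑' p : {p // P p}, (2⁻¹ : ℝ≥0∞) ^ p.1.length ≤ 1 := by
  have hd : Pairwise (Function.onFun Disjoint fun p : {p // P p} => cell p.1) := by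
    intro p p' hne
    refine Set.disjoint_left.2 fun t ht ht' => hne (Subtype.ext ?_)
    rcases prefix_or_prefix_of_mem_cell ht ht' with hc | hc
    · exact hP _ _ p.2 p'.2 hc
    · exact (hP _ _ p'.2 p.2 hc).symm
  calc ∑' p : {p // P p}, (2⁻¹ : ℝ≥0∞) ^ p.1.length
      = ∑' p : {p // P p}, MeasureTheory.volume (cell p.1) :=
        tsum_congr fun p => (volume_cell p.1).symm
    _ = MeasureTheory.volume (⋃ p : {p // P p}, cell p.1) :=
        (MeasureTheory.measure_iUnion hd fun _ => measurableSet_Ico).symm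
    _ ≤ MeasureTheory.volume (Set.Ico (1 : ℝ) 2) :=
        MeasureTheory.measure_mono (Set.iUnion_subset fun p => cell_subset_Ico p.1)
    _ = 1 := by
        rw [Real.volume_Ico]
        norm_num

/-- Every subinterval of `[1, 2)` of length `2 ^ (-l)` contains the dyadic interval of a string of
length `l + 1`. -/
theorem exists_cell_bounds {s : ℝ} {l : ℕ} (h1 : 1 ≤ s) (h2 : s + (2 ^ l)⁻¹ ≤ 2) :
    ∃ p : Str, p.length = l + 1 ∧ s ≤ ((strToNat p : ℝ) + 1) / 2 ^ p.length ∧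
      ((strToNat p : ℝ) + 2) / 2 ^ p.length ≤ s + (2 ^ l)⁻¹ := by
  have hpos : (0 : ℝ) < 2 ^ l := by positivity
  have h2' : s * 2 ^ l + 1 ≤ 2 * 2 ^ l := by
    have := mul_le_mul_of_nonneg_right h2 hpos.le
    rwa [add_mul, inv_mul_cancel₀ hpos.ne'] at this
  obtain ⟨N, hN⟩ : ∃ N, N = ⌈s * 2 ^ (l + 1)⌉₊ := ⟨_, rfl⟩
  have hle : s * 2 ^ (l + 1) ≤ N := hN ▸ Nat.le_ceil _
  have hlt : (N : ℝ) < s * 2 ^ (l + 1) + 1 := hN ▸ Nat.ceil_lt_add_one (by positivity)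
  have hge : 2 ^ (l + 1) ≤ N := by
    have : (2 : ℝ) ^ (l + 1) ≤ N := le_trans (le_mul_of_one_le_left (by positivity) h1) hle
    exact_mod_cast this
  have hub : N < 2 ^ (l + 1 + 1) := by
    have : (N : ℝ) < 2 ^ (l + 1 + 1) := by
      rw [pow_succ, pow_succ]
      rw [pow_succ] at hlt
      linarith
    exact_mod_cast this
  have h0 : 0 < 2 ^ (l + 1) := by positivity
  obtain ⟨M, rfl⟩ : ∃ M, N = M + 1 := ⟨N - 1, by omega⟩
  have hs := strToNat_natToStr M
  have hlen : (natToStr M).length = l + 1 := by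
    obtain ⟨b1, b2⟩ := length_bounds (natToStr M)
    rw [hs] at b1 b2
    have c1 := (Nat.pow_lt_pow_iff_right (a := 2) (by norm_num)).1 (lt_of_le_of_lt b1 hub)
    have c2 := (Nat.pow_lt_pow_iff_right (a := 2) (by norm_num)).1 (lt_of_le_of_lt hge b2)
    omega
  refine ⟨natToStr M, hlen, ?_, ?_⟩
  · rw [hlen, hs, le_div_iff₀ (by positivity)]
    exact_mod_cast hle
  · rw [hlen, hs, div_le_iff₀ (by positivity), add_mul, pow_succ (2 : ℝ) l]
    rw [pow_succ] at hlt
    push_cast at hlt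
    have : ((2 : ℝ) ^ l)⁻¹ * (2 ^ l * 2) = 2 := by field_simp
    rw [this]
    linarith

/-! ### Kraft–Chaitin coding -/

/-- A semidecidable relation that is single-valued and prefix-free for every auxiliary string is
realised by a prefix machine, so the reference machine is as good up to a constant. -/
theorem IsReferenceMachine.exists_condK_le_length {U : Str → Str →. Str}
    (hU : IsReferenceMachine U) {W : Str → Str → Str → Prop}
    (hW : SemiDecidable fun a : (Str × Str) × Str => W a.1.1 a.1.2 a.2)
    (hpf : ∀ y p p' x x', W p y x → W p' y x' → p <+: p' → p = p' ∧ x = x') :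
    ∃ c : ℕ, ∀ p y x, W p y x → condK U x y ≤ p.length + c := by
  obtain ⟨f, hf, hfW⟩ := SemiDecidable.exists_partrec (P := fun a : Str × Str => W a.1 a.2) hW
    fun a b b' h h' => (hpf a.2 a.1 a.1 b b' h h' List.prefix_rfl).2
  have hV : IsPrefixMachine fun p y => f (p, y) := by
    refine ⟨hf.of_eq fun _ => rfl, fun y p p' h h' hp => ?_⟩
    exact (hpf y p p' _ _ ((hfW _ _).1 (Part.get_mem h)) ((hfW _ _).1 (Part.get_mem h')) hp).1
  obtain ⟨s, hs⟩ := hU.universal _ hV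
  refine ⟨s.length, fun p y x h => Nat.sInf_le ⟨s ++ p, ?_, ?_⟩⟩
  · rw [hs]
    exact (hfW (p, y) x).2 h
  · rw [List.length_append, add_comm]

/-- The left endpoint of the interval reserved for stage `n`, when the stages request codewords of
lengths `l` by `some (x, l)`: the number `1` plus the weights `2 ^ (-l)` of the earlier requests.
The pair `(a, k)` stands for the dyadic fraction `a / 2 ^ k`. -/
def leftEnd (e : ℕ → Option (Str × ℕ)) (n : ℕ) : ℕ × ℕ :=
  Nat.rec (1, 0)
    (fun n s => (e n).casesOn s fun w => (s.1 * 2 ^ w.2 + 2 ^ s.2, s.2 + w.2)) n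

/-- The weight `2 ^ (-l)` of a request `some (x, l)`, and `0` for an idle stage. -/
noncomputable def requestWeight (r : Option (Str × ℕ)) : ℝ := r.elim 0 fun w => (2 ^ w.2)⁻¹

theorem requestWeight_nonneg (r : Option (Str × ℕ)) : 0 ≤ requestWeight r := by
  cases r <;> simp [requestWeight]

theorem leftEnd_eq_sum (e : ℕ → Option (Str × ℕ)) (n : ℕ) :
    ((leftEnd e n).1 : ℝ) / 2 ^ (leftEnd e n).2 =
      1 + ∑ m ∈ Finset.range n, requestWeight (e m) := by
  induction n with
  | zero => simp [leftEnd]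
  | succ n ih =>
    rw [Finset.sum_range_succ, ← add_assoc, ← ih]
    change (((e n).casesOn (leftEnd e n) fun w => ((leftEnd e n).1 * 2 ^ w.2 + 2 ^ (leftEnd e n).2,
      (leftEnd e n).2 + w.2) : ℕ × ℕ).1 : ℝ) / 2 ^ ((e n).casesOn (leftEnd e n) fun w =>
      ((leftEnd e n).1 * 2 ^ w.2 + 2 ^ (leftEnd e n).2, (leftEnd e n).2 + w.2) : ℕ × ℕ).2 = _
    cases e n with
    | none => simp [requestWeight]
    | some w =>
      simp only [requestWeight, Option.elim_some, pow_add]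
      push_cast
      field_simp

theorem primrec_strToNat : Primrec strToNat := by
  have hs : Primrec₂ fun (_ : Str) (w : ℕ × Bool) => 2 * w.1 + 1 + w.2.toNat :=
    Primrec.nat_add.comp (Primrec.succ.comp (Primrec.nat_mul.comp (Primrec.const 2)
      (Primrec.fst.comp Primrec.snd)))
      ((Primrec.dom_finite Bool.toNat).comp (Primrec.snd.comp Primrec.snd))
  exact Primrec.list_foldl Primrec.id (Primrec.const 0) hs

theorem primrec_two_pow : Primrec fun n : ℕ => 2 ^ n :=
  (Primrec₂.unpaired'.1 Nat.Primrec.pow).comp (Primrec.const 2) Primrec.id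

theorem primrec_leftEnd {e : Str → ℕ → Option (Str × ℕ)} (he : Primrec₂ e) :
    Primrec₂ fun y n => leftEnd (e y) n := by
  have e1 : Primrec fun a : Str × ℕ × (ℕ × ℕ) => a.2.2 := Primrec.snd.comp Primrec.snd
  have e2 : Primrec fun a : (Str × ℕ × (ℕ × ℕ)) × (Str × ℕ) => a.1.2.2 := e1.comp Primrec.fst
  have e3 : Primrec fun a : (Str × ℕ × (ℕ × ℕ)) × (Str × ℕ) => a.2.2 :=
    Primrec.snd.comp Primrec.snd
  have e4 : Primrec fun a : (Str × ℕ × (ℕ × ℕ)) × (Str × ℕ) =>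
      (a.1.2.2.1 * 2 ^ a.2.2 + 2 ^ a.1.2.2.2, a.1.2.2.2 + a.2.2) :=
    (Primrec.nat_add.comp
      (Primrec.nat_mul.comp (Primrec.fst.comp e2) (primrec_two_pow.comp e3))
      (primrec_two_pow.comp (Primrec.snd.comp e2))).pair
      (Primrec.nat_add.comp (Primrec.snd.comp e2) e3)
  have e5 : Primrec fun a : Str × ℕ × (ℕ × ℕ) => e a.1 a.2.1 :=
    he.comp Primrec.fst (Primrec.fst.comp Primrec.snd)
  exact Primrec.nat_rec (Primrec.const (1, 0)) (Primrec.option_casesOn e5 e1 e4.to₂).to₂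

/-- `p` is a codeword for the request `some (x, l)` of stage `n`: it has length `l + 1`, and its
dyadic interval lies in the interval of length `2 ^ (-l)` that is reserved for stage `n`. -/
def IsCodeword (e : ℕ → Option (Str × ℕ)) (p x : Str) (n l : ℕ) : Prop :=
  e n = some (x, l) ∧ p.length = l + 1 ∧
    (leftEnd e n).1 * 2 ^ p.length ≤ (strToNat p + 1) * 2 ^ (leftEnd e n).2 ∧
    (strToNat p + 2) * 2 ^ (leftEnd e n).2 ≤
      (leftEnd e n).1 * 2 ^ p.length + 2 * 2 ^ (leftEnd e n).2

theorem isCodeword_iff (e : ℕ → Option (Str × ℕ)) (p x : Str) (n l : ℕ) :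
    IsCodeword e p x n l ↔ e n = some (x, l) ∧ p.length = l + 1 ∧
      1 + ∑ m ∈ Finset.range n, requestWeight (e m) ≤ ((strToNat p : ℝ) + 1) / 2 ^ p.length ∧
      ((strToNat p : ℝ) + 2) / 2 ^ p.length ≤
        1 + ∑ m ∈ Finset.range n, requestWeight (e m) + (2 ^ l)⁻¹ := by
  refine and_congr_right fun _ => and_congr_right fun hl => ?_
  rw [← leftEnd_eq_sum]
  generalize leftEnd e n = s
  have h1 : (0 : ℝ) < 2 ^ p.length := by positivity
  have h2 : (0 : ℝ) < 2 ^ s.2 := by positivity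
  have h3 : ((2 : ℝ) ^ l)⁻¹ = 2 / 2 ^ p.length := by
    rw [hl, pow_succ]
    field_simp
  rw [h3, div_add_div _ _ h2.ne' h1.ne', div_le_div_iff₀ h2 h1,
    div_le_div_iff₀ h1 (mul_pos h2 h1)]
  refine and_congr ?_ ?_
  · exact_mod_cast Iff.rfl
  · have h4 : (((strToNat p : ℝ) + 2) * (2 ^ s.2 * 2 ^ p.length) ≤
        ((s.1 : ℝ) * 2 ^ p.length + 2 ^ s.2 * 2) * 2 ^ p.length) ↔
        ((strToNat p : ℝ) + 2) * 2 ^ s.2 ≤ (s.1 : ℝ) * 2 ^ p.length + 2 * 2 ^ s.2 := by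
      rw [← mul_assoc, mul_le_mul_iff_left₀ h1, mul_comm 2 ((2 : ℝ) ^ s.2)]
    rw [h4]
    exact_mod_cast Iff.rfl

theorem IsCodeword.cell_subset {e : ℕ → Option (Str × ℕ)} {p x : Str} {n l : ℕ}
    (h : IsCodeword e p x n l) :
    cell p ⊆ Set.Ico (1 + ∑ m ∈ Finset.range n, requestWeight (e m))
      (1 + ∑ m ∈ Finset.range (n + 1), requestWeight (e m)) := by
  obtain ⟨h1, -, h2, h3⟩ := (isCodeword_iff e p x n l).1 h
  rw [Finset.sum_range_succ, h1, ← add_assoc]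
  exact Set.Ico_subset_Ico h2 h3

theorem IsCodeword.eq_of_prefix {e : ℕ → Option (Str × ℕ)} {p p' x x' : Str} {n n' l l' : ℕ}
    (h : IsCodeword e p x n l) (h' : IsCodeword e p' x' n' l') (hp : p <+: p') :
    p = p' ∧ x = x' := by
  have ht' := left_mem_cell p'
  have ht := h.cell_subset (cell_subset_of_prefix hp ht')
  replace ht' := h'.cell_subset ht'
  -- The intervals of different stages are disjoint, because the left endpoints increase.
  have hmono : Monotone fun n => 1 + ∑ m ∈ Finset.range n, requestWeight (e m) := by
    refine monotone_nat_of_le_succ fun k => ?_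
    rw [Finset.sum_range_succ, ← add_assoc]
    exact le_add_of_nonneg_right (requestWeight_nonneg _)
  have hn : n = n' := by
    have h1 := hmono.reflect_lt (lt_of_le_of_lt ht.1 ht'.2)
    have h2 := hmono.reflect_lt (lt_of_le_of_lt ht'.1 ht.2)
    omega
  subst hn
  have he := h.1.symm.trans h'.1
  simp only [Option.some.injEq, Prod.mk.injEq] at he
  obtain ⟨rfl, rfl⟩ := he
  exact ⟨hp.eq_of_length (h.2.1.trans h'.2.1.symm), rfl⟩

theorem ofReal_requestWeight_some (w : Str × ℕ) :
    ENNReal.ofReal (requestWeight (some w)) = (2⁻¹ : ℝ≥0∞) ^ w.2 :=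
  ofReal_inv_two_pow w.2

theorem sum_requestWeight_le_one {R : Str × ℕ → Prop} {e : ℕ → Option (Str × ℕ)}
    (hR : ∀ n w, w ∈ e n → R w) (hinj : ∀ w n n', w ∈ e n → w ∈ e n' → n = n')
    (hsum : ∑' w : {w // R w}, (2⁻¹ : ℝ≥0∞) ^ w.1.2 ≤ 1) (n : ℕ) :
    ∑ m ∈ Finset.range n, requestWeight (e m) ≤ 1 := by
  have hs : (Function.support fun m => ENNReal.ofReal (requestWeight (e m))) ⊆
      {m | (e m).isSome} := by
    intro m hm
    cases h : e m with
    | none => simp [h, requestWeight] at hm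
    | some w => simp [h]
  let i : {m | (e m).isSome} → {w // R w} := fun m => ⟨(e m).get m.2, hR m _ (Option.get_mem m.2)⟩
  have hi : Function.Injective i := by
    intro m m' h
    have h' : (e m).get m.2 = (e m').get m'.2 := congrArg Subtype.val h
    exact Subtype.ext (hinj _ _ _ (Option.get_mem m.2) (h' ▸ Option.get_mem m'.2))
  have h1 : ∑ m ∈ Finset.range n, ENNReal.ofReal (requestWeight (e m)) ≤ 1 := by
    refine (ENNReal.sum_le_tsum _).trans ?_
    rw [← tsum_subtype_eq_of_support_subset hs]
    refine le_trans ?_ hsum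
    refine le_trans (le_of_eq (tsum_congr fun m => ?_))
      (ENNReal.tsum_comp_le_tsum_of_injective hi fun w : {w // R w} => (2⁻¹ : ℝ≥0∞) ^ w.1.2)
    rw [← ofReal_requestWeight_some]
    change _ = ENNReal.ofReal (requestWeight (some ((e m).get m.2)))
    rw [Option.some_get]
  rw [← ENNReal.ofReal_sum_of_nonneg fun _ _ => requestWeight_nonneg _] at h1
  exact ENNReal.ofReal_le_one.1 h1

/-- **Kraft–Chaitin coding.** A recursively enumerable set of requests `(x, l)`, uniformly in the
auxiliary string `y`, of total weight `∑ 2 ^ (-l) ≤ 1`, can be served by programs of length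
`l + O(1)`. The constant does not depend on `y`, and the weight condition is needed only for the
`y` in question. -/
theorem IsReferenceMachine.kraft_chaitin {U : Str → Str →. Str} (hU : IsReferenceMachine U)
    {R : Str → Str × ℕ → Prop} (hR : SemiDecidable fun a : Str × (Str × ℕ) => R a.1 a.2) :
    ∃ c : ℕ, ∀ y x l, ∑' w : {w // R y w}, (2⁻¹ : ℝ≥0∞) ^ w.1.2 ≤ 1 → R y (x, l) →
      condK U x y ≤ l + c := by
  obtain ⟨e, he, hsound, hcomplete, hinj⟩ := hR.exists_enumeration
  have hW : SemiDecidable fun a : (Str × Str) × Str =>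
      ∃ n l, IsCodeword (e a.1.2) a.1.1 a.2 n l := by
    refine .exists_right (P := fun (a : (Str × Str) × Str) n =>
      ∃ l, IsCodeword (e a.1.2) a.1.1 a.2 n l) ?_
    refine .exists_right (P := fun (a : ((Str × Str) × Str) × ℕ) l =>
      IsCodeword (e a.1.1.2) a.1.1.1 a.1.2 a.2 l) (.of_primrecPred ?_)
    have ep : Primrec fun a : (((Str × Str) × Str) × ℕ) × ℕ => a.1.1.1.1 :=
      .comp .fst (.comp .fst (.comp .fst .fst))
    have ey : Primrec fun a : (((Str × Str) × Str) × ℕ) × ℕ => a.1.1.1.2 :=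
      .comp .snd (.comp .fst (.comp .fst .fst))
    have ex : Primrec fun a : (((Str × Str) × Str) × ℕ) × ℕ => a.1.1.2 :=
      .comp .snd (.comp .fst .fst)
    have en : Primrec fun a : (((Str × Str) × Str) × ℕ) × ℕ => a.1.2 := .comp .snd .fst
    have hE := (primrec_leftEnd he).comp ey en
    have hE2 := primrec_two_pow.comp (Primrec.snd.comp hE)
    have hN := primrec_strToNat.comp ep
    have hM := Primrec.nat_mul.comp (Primrec.fst.comp hE)
      (primrec_two_pow.comp (Primrec.list_length.comp ep))
    refine (Primrec.eq.comp (he.comp ey en) (Primrec.option_some.comp (ex.pair .snd))).and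
      ((Primrec.eq.comp (Primrec.list_length.comp ep) (Primrec.succ.comp .snd)).and
      ((Primrec.nat_le.comp hM ?_).and (Primrec.nat_le.comp ?_ ?_)))
    · exact Primrec.nat_mul.comp (Primrec.nat_add.comp hN (.const 1)) hE2
    · exact Primrec.nat_mul.comp (Primrec.nat_add.comp hN (.const 2)) hE2
    · exact Primrec.nat_add.comp hM (Primrec.nat_mul.comp (.const 2) hE2)
  obtain ⟨c, hc⟩ := hU.exists_condK_le_length
    (W := fun p y x => ∃ n l, IsCodeword (e y) p x n l) hW
    fun y p p' x x' ⟨n, l, h⟩ ⟨n', l', h'⟩ hp => h.eq_of_prefix h' hp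
  refine ⟨1 + c, fun y x l hsum hx => ?_⟩
  obtain ⟨n, hn⟩ := hcomplete y (x, l) hx
  have hle := sum_requestWeight_le_one (hsound y) (hinj y) hsum
  have h0 : 0 ≤ ∑ m ∈ Finset.range n, requestWeight (e y m) :=
    Finset.sum_nonneg fun _ _ => requestWeight_nonneg _
  have h2 := hle (n + 1)
  rw [Finset.sum_range_succ, hn] at h2
  change _ + (2 ^ l)⁻¹ ≤ (1 : ℝ) at h2
  obtain ⟨p, hp, hp1, hp2⟩ := exists_cell_bounds
    (s := 1 + ∑ m ∈ Finset.range n, requestWeight (e y m)) (l := l) (by linarith) (by linarith)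
  have := hc p y x ⟨n, l, (isCodeword_iff _ _ _ _ _).2 ⟨hn, hp, hp1, hp2⟩⟩
  omega

/-! ### The coding theorem -/

theorem primrecPred_nodup {α : Type*} [Primcodable α] :
    PrimrecPred fun L : List α => L.Nodup := by
  classical
  have h1 : PrimrecRel fun (l : List α) (a : α) => ∃ b ∈ l, b = a :=
    PrimrecRel.exists_mem_list Primrec.eq
  have h2 : Primrec fun w : List α × (α × List α × Bool) =>
      if ∃ b ∈ w.2.2.1, b = w.2.1 then false else w.2.2.2 :=
    Primrec.ite (PrimrecRel.comp h1 (.comp .fst (.comp .snd .snd)) (.comp .fst .snd))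
      (.const false) (.comp .snd (.comp .snd .snd))
  have h3 := Primrec.list_rec (f := fun L : List α => L) Primrec.id (Primrec.const true) h2.to₂
  refine (Primrec.eq.comp h3 (Primrec.const true)).of_eq fun L => ?_
  induction L with
  | nil => simp
  | cons a L ih =>
    rw [List.nodup_cons, ← ih]
    simp

/-- The probability `∑ 2 ^ (-|p|)` that a random program is related to `x`. -/
noncomputable def mass (Q : Str → Str → Prop) (x : Str) : ℝ≥0∞ :=
  ∑' p : {p // Q p x}, (2⁻¹ : ℝ≥0∞) ^ p.1.length

theorem tsum_mass_le_one {Q : Str → Str → Prop}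
    (hpf : ∀ p p' x x', Q p x → Q p' x' → p <+: p' → p = p' ∧ x = x') :
    ∑' x, mass Q x ≤ 1 := by
  have hk := kraft_inequality (P := fun p => ∃ x, Q p x)
    fun p p' ⟨x, h⟩ ⟨x', h'⟩ hp => (hpf p p' x x' h h' hp).1
  refine le_trans ?_ hk
  let i : (Σ x, {p // Q p x}) → {p // ∃ x, Q p x} := fun s => ⟨s.2.1, s.1, s.2.2⟩
  have hi : Function.Injective i := by
    rintro ⟨x, p, h⟩ ⟨x', p', h'⟩ he
    obtain rfl : p = p' := congrArg Subtype.val he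
    obtain rfl := (hpf p p x x' h h' List.prefix_rfl).2
    rfl
  refine le_trans (le_of_eq ?_) (ENNReal.tsum_comp_le_tsum_of_injective hi
    fun p : {p // ∃ x, Q p x} => (2⁻¹ : ℝ≥0∞) ^ p.1.length)
  rw [ENNReal.tsum_sigma']
  rfl

theorem tsum_subtype_eq_tsum_indicator {α : Type*} (P : α → Prop) (g : α → ℝ≥0∞) :
    ∑' a : {a // P a}, g a.1 = ∑' a, Set.indicator {a : α | P a} g a :=
  tsum_subtype _ _

theorem list_sum_le_mass {Q : Str → Str → Prop} {x : Str} {L : List Str} (hL : L.Nodup)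
    (h : ∀ p ∈ L, Q p x) : (L.map fun p => (2⁻¹ : ℝ≥0∞) ^ p.length).sum ≤ mass Q x := by
  rw [← List.sum_toFinset _ hL, mass,
    tsum_subtype_eq_tsum_indicator (fun p => Q p x) (fun p : Str => (2⁻¹ : ℝ≥0∞) ^ p.length)]
  refine le_trans (le_of_eq (Finset.sum_congr rfl fun p hp => ?_)) (ENNReal.sum_le_tsum _)
  exact (Set.indicator_of_mem (s := {p | Q p x}) (h p (List.mem_toFinset.1 hp))
    fun p : Str => (2⁻¹ : ℝ≥0∞) ^ p.length).symm

theorem exists_list_of_lt_mass {Q : Str → Str → Prop} {x : Str} {t : ℝ≥0∞} (h : t < mass Q x) :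
    ∃ L : List Str, L.Nodup ∧ (∀ p ∈ L, Q p x) ∧
      t < (L.map fun p => (2⁻¹ : ℝ≥0∞) ^ p.length).sum := by
  rw [mass, ENNReal.tsum_eq_iSup_sum, lt_iSup_iff] at h
  obtain ⟨s, hs⟩ := h
  refine ⟨s.toList.map Subtype.val, s.nodup_toList.map Subtype.val_injective, ?_, ?_⟩
  · intro p hp
    obtain ⟨q, -, rfl⟩ := List.mem_map.1 hp
    exact q.2
  · rwa [List.map_map, Function.comp_def, Finset.sum_map_toList]

/-- Distinct powers `2 ^ (-l)` with `2 * 2 ^ (-l) ≤ m` form a geometric series with sum at most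
`m`. -/
theorem tsum_half_pow_le {P : ℕ → Prop} {m : ℝ≥0∞} (h : ∀ l, P l → 2 * (2⁻¹ : ℝ≥0∞) ^ l ≤ m) :
    ∑' l : {l // P l}, (2⁻¹ : ℝ≥0∞) ^ l.1 ≤ m := by
  classical
  by_cases hex : ∃ l, P l
  · refine le_trans ?_ (h _ (Nat.find_spec hex))
    have hle : ∀ l : {l // P l}, Nat.find hex ≤ l.1 := fun l => Nat.find_min' hex l.2
    have hi : Function.Injective fun l : {l // P l} => l.1 - Nat.find hex := by
      intro l l' he
      have h1 := hle l
      have h2 := hle l'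
      have h3 : l.1 - Nat.find hex = l'.1 - Nat.find hex := he
      exact Subtype.ext (by omega)
    calc ∑' l : {l // P l}, (2⁻¹ : ℝ≥0∞) ^ l.1
        = ∑' l : {l // P l}, (2⁻¹ : ℝ≥0∞) ^ Nat.find hex * 2⁻¹ ^ (l.1 - Nat.find hex) :=
          tsum_congr fun l => by rw [← pow_add, Nat.add_sub_cancel' (hle l)]
      _ = (2⁻¹ : ℝ≥0∞) ^ Nat.find hex * ∑' l : {l // P l}, 2⁻¹ ^ (l.1 - Nat.find hex) :=
          ENNReal.tsum_mul_left
      _ ≤ (2⁻¹ : ℝ≥0∞) ^ Nat.find hex * ∑' k : ℕ, 2⁻¹ ^ k := by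
          gcongr
          exact ENNReal.tsum_comp_le_tsum_of_injective hi fun k : ℕ => (2⁻¹ : ℝ≥0∞) ^ k
      _ = 2 * (2⁻¹ : ℝ≥0∞) ^ Nat.find hex := by
          rw [ENNReal.tsum_geometric, ENNReal.one_sub_inv_two, inv_inv, mul_comm]
  · have : IsEmpty {l // P l} := ⟨fun l => hex ⟨l.1, l.2⟩⟩
    simp

theorem inv_two_pow_mul_two_pow {a M : ℕ} (h : a ≤ M) :
    (2⁻¹ : ℝ≥0∞) ^ a * 2 ^ M = 2 ^ (M - a) := by
  conv_lhs => rw [← Nat.add_sub_cancel' h]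
  rw [pow_add, ← mul_assoc, ← mul_pow, ENNReal.inv_mul_cancel (by norm_num) (by norm_num), one_pow,
    one_mul]

theorem list_sum_mul_two_pow {M : ℕ} {L : List Str} (h : ∀ p ∈ L, p.length ≤ M) :
    (L.map fun p => (2⁻¹ : ℝ≥0∞) ^ p.length).sum * 2 ^ M =
      ((L.foldr (fun p s => 2 ^ (M - p.length) + s) 0 : ℕ) : ℝ≥0∞) := by
  induction L with
  | nil => simp
  | cons p L ih =>
    rw [List.map_cons, List.sum_cons, add_mul, ih fun q hq => h q (List.mem_cons_of_mem _ hq),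
      inv_two_pow_mul_two_pow (h p List.mem_cons_self), List.foldr_cons]
    push_cast
    rfl

/-- The requests of the coding theorem: codewords of length `l` are requested for those `x` whose
mass exceeds `2 * 2 ^ (-l)`, which shows up in a finite list `L` of programs. The weights of the
list are computed with the common denominator `2 ^ M`. -/
def MassRequest (Q : Str → Str → Prop) (x : Str) (l : ℕ) : Prop :=
  ∃ L : List Str, (∀ p ∈ L, Q p x) ∧ ∃ M : ℕ, L.Nodup ∧ (∀ p ∈ L, p.length ≤ M) ∧
    2 * 2 ^ M ≤ 2 ^ l * L.foldr (fun p s => 2 ^ (M - p.length) + s) 0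

theorem massRequest_iff {Q : Str → Str → Prop} {x : Str} {l : ℕ} :
    MassRequest Q x l ↔ ∃ L : List Str, L.Nodup ∧ (∀ p ∈ L, Q p x) ∧
      2 * (2⁻¹ : ℝ≥0∞) ^ l ≤ (L.map fun p => (2⁻¹ : ℝ≥0∞) ^ p.length).sum := by
  have key : ∀ {L : List Str} {M : ℕ}, (∀ p ∈ L, p.length ≤ M) →
      (2 * 2 ^ M ≤ 2 ^ l * L.foldr (fun p s => 2 ^ (M - p.length) + s) 0 ↔
        2 * (2⁻¹ : ℝ≥0∞) ^ l ≤ (L.map fun p => (2⁻¹ : ℝ≥0∞) ^ p.length).sum) := by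
    intro L M hM
    have hl : (2 : ℝ≥0∞) ^ l * 2⁻¹ ^ l = 1 := by
      rw [mul_comm, inv_two_pow_mul_two_pow le_rfl, Nat.sub_self, pow_zero]
    rw [← ENNReal.mul_le_mul_iff_left (c := 2 ^ M * 2 ^ l) (by positivity)
      (ENNReal.mul_ne_top (by finiteness) (by finiteness)), ← mul_assoc (L.map _).sum,
      list_sum_mul_two_pow hM,
      show 2 * (2⁻¹ : ℝ≥0∞) ^ l * (2 ^ M * 2 ^ l) = 2 * 2 ^ M * (2 ^ l * 2⁻¹ ^ l) by ring, hl,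
      mul_one, mul_comm _ ((2 : ℝ≥0∞) ^ l)]
    exact_mod_cast Iff.rfl
  constructor
  · rintro ⟨L, hQ, M, hL, hM, h⟩
    exact ⟨L, hL, hQ, (key hM).1 h⟩
  · rintro ⟨L, hL, hQ, h⟩
    have hM : ∀ p ∈ L, p.length ≤ (L.map List.length).sum := fun p hp =>
      List.le_sum_of_mem (List.mem_map_of_mem hp)
    exact ⟨L, hQ, _, hL, hM, (key hM).2 h⟩

theorem semiDecidable_massRequest {Q : Str → Str → Prop}
    (hQ : SemiDecidable fun a : Str × Str => Q a.1 a.2) :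
    SemiDecidable fun a : Str × ℕ => MassRequest Q a.1 a.2 := by
  refine .exists_right (P := fun (a : Str × ℕ) (L : List Str) => (∀ p ∈ L, Q p a.1) ∧ ∃ M : ℕ,
    L.Nodup ∧ (∀ p ∈ L, p.length ≤ M) ∧
      2 * 2 ^ M ≤ 2 ^ a.2 * L.foldr (fun p s => 2 ^ (M - p.length) + s) 0)
    (.and (hQ.forall_mem_list.comp (Primrec.snd.pair (.comp .fst .fst)))
    (.exists_right (P := fun (a : (Str × ℕ) × List Str) (M : ℕ) =>
      a.2.Nodup ∧ (∀ p ∈ a.2, p.length ≤ M) ∧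
      2 * 2 ^ M ≤ 2 ^ a.1.2 * a.2.foldr (fun p s => 2 ^ (M - p.length) + s) 0)
    (.of_primrecPred ?_)))
  have eL : Primrec fun a : ((Str × ℕ) × List Str) × ℕ => a.1.2 := .comp .snd .fst
  have el : Primrec fun a : ((Str × ℕ) × List Str) × ℕ => a.1.1.2 := .comp .snd (.comp .fst .fst)
  have h1 : PrimrecRel fun (p : Str) (M : ℕ) => p.length ≤ M :=
    Primrec.nat_le.comp (Primrec.list_length.comp .fst) .snd
  have h2 : Primrec₂ fun (a : ((Str × ℕ) × List Str) × ℕ) (w : Str × ℕ) =>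
      2 ^ (a.2 - w.1.length) + w.2 :=
    Primrec.nat_add.comp (primrec_two_pow.comp (Primrec.nat_sub.comp (.comp .snd .fst)
      (Primrec.list_length.comp (.comp .fst .snd)))) (.comp .snd .snd)
  have h3 : Primrec fun a : ((Str × ℕ) × List Str) × ℕ =>
      a.1.2.foldr (fun p s => 2 ^ (a.2 - p.length) + s) 0 :=
    Primrec.list_foldr eL (.const 0) h2
  exact (primrecPred_nodup.comp eL).and ((PrimrecRel.comp
    (PrimrecRel.forall_mem_list h1) eL .snd).and
    (Primrec.nat_le.comp (Primrec.nat_mul.comp (.const 2) (primrec_two_pow.comp .snd))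
      (Primrec.nat_mul.comp (primrec_two_pow.comp el) h3)))

/-- **The coding theorem**: the probability that a random program of the prefix machine with graph
`Q` produces `x` is at most `2 ^ (c - K(x))`. -/
theorem IsReferenceMachine.coding_theorem {U : Str → Str →. Str} (hU : IsReferenceMachine U)
    {Q : Str → Str → Prop} (hQ : SemiDecidable fun a : Str × Str => Q a.1 a.2)
    (hpf : ∀ p p' x x', Q p x → Q p' x' → p <+: p' → p = p' ∧ x = x') :
    ∃ c : ℕ, ∀ x, 2 ^ K U x * mass Q x ≤ 2 ^ c := by
  obtain ⟨c, hc⟩ := hU.kraft_chaitin (R := fun _ w => MassRequest Q w.1 w.2)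
    ((semiDecidable_massRequest hQ).comp Primrec.snd)
  -- The requests for `x` form a geometric series that is bounded by the mass of `x`.
  have hsum : ∑' w : {w : Str × ℕ // MassRequest Q w.1 w.2}, (2⁻¹ : ℝ≥0∞) ^ w.1.2 ≤ 1 := by
    refine le_trans ?_ (tsum_mass_le_one hpf)
    rw [tsum_subtype_eq_tsum_indicator (fun w : Str × ℕ => MassRequest Q w.1 w.2)
      (fun w => (2⁻¹ : ℝ≥0∞) ^ w.2),
      ENNReal.tsum_prod']
    refine ENNReal.tsum_le_tsum fun x => ?_
    refine le_trans (le_of_eq ?_) (tsum_half_pow_le (P := fun l => MassRequest Q x l) ?_)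
    · rw [tsum_subtype_eq_tsum_indicator (MassRequest Q x) (fun l => (2⁻¹ : ℝ≥0∞) ^ l)]
      rfl
    · intro l hl
      obtain ⟨L, hL, hLQ, h⟩ := massRequest_iff.1 hl
      exact h.trans (list_sum_le_mass hL hLQ)
  refine ⟨c + 2, fun x => ?_⟩
  -- Otherwise a codeword of length `l = K(x) - c - 1` is requested, whence `K(x) ≤ l + c < K(x)`.
  by_contra! hlt
  rcases Nat.lt_or_ge (K U x) (c + 2) with hK | hK
  · have h1 : mass Q x ≤ 1 := (ENNReal.le_tsum x).trans (tsum_mass_le_one hpf)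
    have h2 : (2 : ℝ≥0∞) ^ K U x * mass Q x ≤ 2 ^ (c + 2) * 1 := by
      gcongr
      norm_num
    rw [mul_one] at h2
    exact absurd h2 (not_le.2 hlt)
  · obtain ⟨l, hl⟩ : ∃ l, K U x = l + (c + 1) := ⟨K U x - (c + 1), by omega⟩
    have h1 : 2 * (2⁻¹ : ℝ≥0∞) ^ l < mass Q x := by
      by_contra! h
      have h2 : (2 : ℝ≥0∞) ^ K U x * mass Q x ≤ 2 ^ K U x * (2 * 2⁻¹ ^ l) := by gcongr
      have h3 : (2 : ℝ≥0∞) ^ K U x * (2 * 2⁻¹ ^ l) = 2 ^ (c + 2) := by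
        rw [hl, pow_add, show (2 : ℝ≥0∞) ^ l * 2 ^ (c + 1) * (2 * 2⁻¹ ^ l) =
          2 ^ (c + 2) * (2⁻¹ ^ l * 2 ^ l) by ring, inv_two_pow_mul_two_pow le_rfl, Nat.sub_self,
          pow_zero, mul_one]
      exact absurd (h2.trans_eq h3) (not_le.2 hlt)
    obtain ⟨L, hL, hLQ, h⟩ := exists_list_of_lt_mass h1
    have := hc [] x l hsum (massRequest_iff.2 ⟨L, hL, hLQ, h.le⟩)
    change K U x ≤ l + c at this
    omega

/-! ### Symmetry of information -/

/-- The hard direction of the symmetry of information: a program of a prefix machine for a pair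
`(x, y)` has length at least `K(x) + K(y | x*) - O(1)`. -/
theorem IsReferenceMachine.exists_K_add_condK_le {U : Str → Str →. Str}
    (hU : IsReferenceMachine U) {W : Str → Str → Str → Prop}
    (hW : SemiDecidable fun a : Str × Str × Str => W a.1 a.2.1 a.2.2)
    (hpf : ∀ p p' x x' y y', W p x y → W p' x' y' → p <+: p' → p = p' ∧ x = x' ∧ y = y') :
    ∃ c : ℕ, ∀ p x y, W p x y →
      K U x + condK U y (shortestProgram U x) ≤ p.length + c := by
  have hQ : SemiDecidable fun a : Str × Str => ∃ y, W a.1 a.2 y :=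
    .exists_right (P := fun (a : Str × Str) y => W a.1 a.2 y)
      (hW.comp ((Primrec.fst.comp .fst).pair ((Primrec.snd.comp .fst).pair .snd)))
  obtain ⟨c, hc⟩ := hU.coding_theorem (Q := fun p x => ∃ y, W p x y) hQ
    fun p p' x x' ⟨y, h⟩ ⟨y', h'⟩ hp =>
      ⟨(hpf p p' x x' y y' h h' hp).1, (hpf p p' x x' y y' h h' hp).2.1⟩
  -- With the auxiliary string `w = x*`, whose length is `K(x)`, a program `p` for `(x, v)` requests
  -- a codeword of length `|p| + c - K(x)` for `v`.
  let R : Str → Str × ℕ → Prop := fun w r =>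
    ∃ x p, x ∈ U w [] ∧ W p x r.1 ∧ p.length + c = r.2 + w.length
  have hR : SemiDecidable fun a : Str × (Str × ℕ) => R a.1 a.2 := by
    refine .exists_right (P := fun (a : Str × (Str × ℕ)) x =>
      ∃ p, x ∈ U a.1 [] ∧ W p x a.2.1 ∧ p.length + c = a.2.2 + a.1.length) ?_
    refine .exists_right (P := fun (a : (Str × (Str × ℕ)) × Str) p =>
      a.2 ∈ U a.1.1 [] ∧ W p a.2 a.1.2.1 ∧ p.length + c = a.1.2.2 + a.1.1.length) ?_
    have ew : Primrec fun a : ((Str × (Str × ℕ)) × Str) × Str => a.1.1.1 :=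
      .comp .fst (.comp .fst .fst)
    have er : Primrec fun a : ((Str × (Str × ℕ)) × Str) × Str => a.1.1.2 :=
      .comp .snd (.comp .fst .fst)
    have ex : Primrec fun a : ((Str × (Str × ℕ)) × Str) × Str => a.1.2 := .comp .snd .fst
    refine .and ((SemiDecidable.graph hU.partrec).comp ((ew.pair (.const [])).pair ex))
      (.and (hW.comp (Primrec.snd.pair (ex.pair (Primrec.fst.comp er)))) (.of_primrecPred ?_))
    exact Primrec.eq.comp (Primrec.nat_add.comp (Primrec.list_length.comp .snd) (.const c))
      (Primrec.nat_add.comp (Primrec.snd.comp er) (Primrec.list_length.comp ew))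
  obtain ⟨d, hd⟩ := hU.kraft_chaitin hR
  refine ⟨c + d, fun p x y hp => ?_⟩
  obtain ⟨hx, hlen⟩ := hU.shortestProgram_spec x
  have hpow : ∀ n : ℕ, (2⁻¹ : ℝ≥0∞) ^ n * 2 ^ n = 1 := fun n => by
    rw [inv_two_pow_mul_two_pow le_rfl, Nat.sub_self, pow_zero]
  have hsum : ∑' r : {r // R (shortestProgram U x) r}, (2⁻¹ : ℝ≥0∞) ^ r.1.2 ≤ 1 := by
    have hchoose : ∀ r : {r // R (shortestProgram U x) r}, ∃ p, W p x r.1.1 ∧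
        p.length + c = r.1.2 + K U x := by
      rintro ⟨r, x', p, hx', hW', hl⟩
      obtain rfl := Part.mem_unique hx hx'
      exact ⟨p, hW', hl.trans (congrArg _ hlen)⟩
    choose f hfW hfl using hchoose
    let i : {r // R (shortestProgram U x) r} → {p // ∃ y, W p x y} := fun r => ⟨f r, _, hfW r⟩
    have hi : Function.Injective i := by
      intro r r' he
      have he' : f r = f r' := congrArg Subtype.val he
      have h1 := (hpf _ _ _ _ _ _ (hfW r) (hfW r') (by rw [he'])).2.2
      have h2 := hfl r
      have h3 := hfl r'
      rw [he'] at h2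
      exact Subtype.ext (Prod.ext h1 (by omega))
    calc ∑' r : {r // R (shortestProgram U x) r}, (2⁻¹ : ℝ≥0∞) ^ r.1.2
        = ∑' r, (2⁻¹ ^ c * 2 ^ K U x) * (2⁻¹ : ℝ≥0∞) ^ (f r).length := by
          refine tsum_congr fun r => ?_
          rw [mul_right_comm, ← pow_add, add_comm c, hfl r, pow_add, mul_assoc, hpow, mul_one]
      _ = (2⁻¹ ^ c * 2 ^ K U x) * ∑' r, (2⁻¹ : ℝ≥0∞) ^ (f r).length := ENNReal.tsum_mul_left
      _ ≤ (2⁻¹ ^ c * 2 ^ K U x) * mass (fun p x => ∃ y, W p x y) x := by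
          gcongr
          exact ENNReal.tsum_comp_le_tsum_of_injective hi
            fun p : {p // ∃ y, W p x y} => (2⁻¹ : ℝ≥0∞) ^ p.1.length
      _ ≤ 2⁻¹ ^ c * 2 ^ c := by
          rw [mul_assoc]
          gcongr
          exact hc x
      _ = 1 := hpow c
  -- The requested length is not negative, because `p` alone contributes to the mass of `x`.
  have hK : K U x ≤ p.length + c := by
    have h1 : (2⁻¹ : ℝ≥0∞) ^ p.length ≤ mass (fun p x => ∃ y, W p x y) x :=
      ENNReal.le_tsum (f := fun p : {p // ∃ y, W p x y} => (2⁻¹ : ℝ≥0∞) ^ p.1.length) ⟨p, y, hp⟩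
    have h2 : (2 : ℝ≥0∞) ^ K U x ≤ 2 ^ (p.length + c) := by
      calc (2 : ℝ≥0∞) ^ K U x = 2 ^ K U x * 2⁻¹ ^ p.length * 2 ^ p.length := by
            rw [mul_assoc, hpow, mul_one]
        _ ≤ 2 ^ K U x * mass (fun p x => ∃ y, W p x y) x * 2 ^ p.length := by gcongr
        _ ≤ 2 ^ c * 2 ^ p.length := by
            gcongr
            exact hc x
        _ = 2 ^ (p.length + c) := by rw [← pow_add, add_comm]
    have h3 : (2 : ℕ) ^ K U x ≤ 2 ^ (p.length + c) := by exact_mod_cast h2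
    exact (Nat.pow_le_pow_iff_right (by norm_num)).1 h3
  have := hd (shortestProgram U x) y (p.length + c - K U x) hsum
    ⟨x, p, hx, hp, by rw [hlen]; exact (Nat.sub_add_cancel hK).symm⟩
  omega

/-! ### Machines that run several programs in succession -/

theorem IsPrefixMachine.split_unique {U : Str → Str →. Str} (hU : IsPrefixMachine U)
    {y p p' r r' x x' : Str} (h : x ∈ U p y) (h' : x' ∈ U p' y) (hp : p ++ r <+: p' ++ r') :
    p = p' ∧ r <+: r' := by
  have hd := Part.dom_iff_mem.2 ⟨x, h⟩
  have hd' := Part.dom_iff_mem.2 ⟨x', h'⟩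
  have h1 : p <+: p' ++ r' := (List.prefix_append p r).trans hp
  have h2 : p' <+: p' ++ r' := List.prefix_append p' r'
  have he : p = p' := by
    rcases le_total p.length p'.length with hl | hl
    · exact hU.prefixFree y p p' hd hd' (List.prefix_of_prefix_length_le h1 h2 hl)
    · exact (hU.prefixFree y p' p hd' hd (List.prefix_of_prefix_length_le h2 h1 hl)).symm
  subst he
  exact ⟨rfl, (List.prefix_append_right_inj p).1 hp⟩

theorem IsPrefixMachine.eq_of_prefix {U : Str → Str →. Str} (hU : IsPrefixMachine U)
    {y p p' x x' : Str} (h : x ∈ U p y) (h' : x' ∈ U p' y) (hp : p <+: p') : p = p' ∧ x = x' := by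
  obtain rfl := hU.prefixFree y p p' (Part.dom_iff_mem.2 ⟨x, h⟩) (Part.dom_iff_mem.2 ⟨x', h'⟩) hp
  exact ⟨rfl, Part.mem_unique h h'⟩

theorem IsPrefixMachine.semiDecidable_mem {U : Str → Str →. Str} (hU : IsPrefixMachine U)
    {α : Type*} [Primcodable α] {p y x : α → Str} (hp : Primrec p) (hy : Primrec y)
    (hx : Primrec x) : SemiDecidable fun a => x a ∈ U (p a) (y a) :=
  (SemiDecidable.graph hU.partrec).comp ((hp.pair hy).pair hx)

theorem IsReferenceMachine.exists_program_length_eq {U : Str → Str →. Str}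
    (hU : IsReferenceMachine U) (x y : Str) : ∃ p, x ∈ U p y ∧ p.length = condK U x y := by
  obtain ⟨p, hp⟩ := hU.exists_program x y
  exact Nat.sInf_mem (s := {l : ℕ | ∃ p : Str, x ∈ U p y ∧ p.length = l}) ⟨_, p, hp, rfl⟩

/-- A shortest program for `z`, followed by shortest programs for `x` and `y` given `z*`, describes
the pair `(x, y)`. -/
theorem IsReferenceMachine.exists_K_add_condK_le_via {U : Str → Str →. Str}
    (hU : IsReferenceMachine U) : ∃ c : ℕ, ∀ x y z,
      K U x + condK U y (shortestProgram U x) ≤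
        K U z + condK U x (shortestProgram U z) + condK U y (shortestProgram U z) + c := by
  have hW := hU.exists_K_add_condK_le (W := fun p x y => ∃ s : Str × Str × Str × Str,
      p = s.2.1 ++ (s.2.2.1 ++ s.2.2.2) ∧ s.1 ∈ U s.2.1 [] ∧ x ∈ U s.2.2.1 s.2.1 ∧
        y ∈ U s.2.2.2 s.2.1) ?_ ?_
  · obtain ⟨c, hc⟩ := hW
    refine ⟨c, fun x y z => ?_⟩
    obtain ⟨hz, hlz⟩ := hU.shortestProgram_spec z
    obtain ⟨p, hp, hlp⟩ := hU.exists_program_length_eq x (shortestProgram U z)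
    obtain ⟨q, hq, hlq⟩ := hU.exists_program_length_eq y (shortestProgram U z)
    have := hc _ x y ⟨(z, shortestProgram U z, p, q), rfl, hz, hp, hq⟩
    simp only [List.length_append] at this
    omega
  · refine .exists_right (P := fun (a : Str × Str × Str) (s : Str × Str × Str × Str) =>
      a.1 = s.2.1 ++ (s.2.2.1 ++ s.2.2.2) ∧ s.1 ∈ U s.2.1 [] ∧ a.2.1 ∈ U s.2.2.1 s.2.1 ∧
        a.2.2 ∈ U s.2.2.2 s.2.1) ?_
    have e1 : Primrec fun a : (Str × Str × Str) × (Str × Str × Str × Str) => a.2.2.1 :=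
      .comp .fst (.comp .snd .snd)
    have e2 : Primrec fun a : (Str × Str × Str) × (Str × Str × Str × Str) => a.2.2.2.1 :=
      .comp .fst (.comp .snd (.comp .snd .snd))
    have e3 : Primrec fun a : (Str × Str × Str) × (Str × Str × Str × Str) => a.2.2.2.2 :=
      .comp .snd (.comp .snd (.comp .snd .snd))
    exact .and (.of_primrecPred (Primrec.eq.comp (.comp .fst .fst)
      (Primrec.list_append.comp e1 (Primrec.list_append.comp e2 e3))))
      (.and (hU.semiDecidable_mem e1 (.const []) (.comp .fst .snd))
      (.and (hU.semiDecidable_mem e2 e1 (.comp .fst (.comp .snd .fst)))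
      (hU.semiDecidable_mem e3 e1 (.comp .snd (.comp .snd .fst)))))
  · rintro p p' x x' y y' ⟨⟨z, p1, p2, p3⟩, rfl, hz, hx, hy⟩
      ⟨⟨z', p1', p2', p3'⟩, rfl, hz', hx', hy'⟩ hp
    obtain ⟨rfl, hp⟩ := hU.split_unique hz hz' hp
    obtain ⟨rfl, hp⟩ := hU.split_unique hx hx' hp
    obtain ⟨rfl, rfl⟩ := hU.eq_of_prefix hy hy' hp
    exact ⟨rfl, Part.mem_unique hx hx', rfl⟩

/-- A program `q` computing `z` from `x*` bounds `K(z) + K(x | z*)` by `K(x) + l(q) + O(1)`, since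
`x*` followed by `q` describes the pair `(z, x)`. -/
theorem IsReferenceMachine.exists_K_add_condK_le_add_length {U : Str → Str →. Str}
    (hU : IsReferenceMachine U) : ∃ c : ℕ, ∀ x z q, z ∈ U q (shortestProgram U x) →
      K U z + condK U x (shortestProgram U z) ≤ K U x + q.length + c := by
  have hW := hU.exists_K_add_condK_le (W := fun p z x => ∃ s : Str × Str,
      p = s.1 ++ s.2 ∧ x ∈ U s.1 [] ∧ z ∈ U s.2 s.1) ?_ ?_
  · obtain ⟨c, hc⟩ := hW
    refine ⟨c, fun x z q hq => ?_⟩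
    obtain ⟨hx, hlx⟩ := hU.shortestProgram_spec x
    have := hc _ z x ⟨(shortestProgram U x, q), rfl, hx, hq⟩
    rwa [List.length_append, hlx] at this
  · refine .exists_right (P := fun (a : Str × Str × Str) (s : Str × Str) =>
      a.1 = s.1 ++ s.2 ∧ a.2.2 ∈ U s.1 [] ∧ a.2.1 ∈ U s.2 s.1) ?_
    have e1 : Primrec fun a : (Str × Str × Str) × (Str × Str) => a.2.1 := .comp .fst .snd
    have e2 : Primrec fun a : (Str × Str × Str) × (Str × Str) => a.2.2 := .comp .snd .snd
    exact .and (.of_primrecPred (Primrec.eq.comp (.comp .fst .fst)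
      (Primrec.list_append.comp e1 e2)))
      (.and (hU.semiDecidable_mem e1 (.const []) (.comp .snd (.comp .snd .fst)))
      (hU.semiDecidable_mem e2 e1 (.comp .fst (.comp .snd .fst))))
  · rintro p p' z z' x x' ⟨⟨p1, p2⟩, rfl, hx, hz⟩ ⟨⟨p1', p2'⟩, rfl, hx', hz'⟩ hp
    obtain ⟨rfl, hp⟩ := hU.split_unique hx hx' hp
    obtain ⟨rfl, rfl⟩ := hU.eq_of_prefix hz hz' hp
    exact ⟨rfl, rfl, Part.mem_unique hx hx'⟩

/-- The same with `K(q)` instead of `l(q)`: here `x*` is followed by a shortest program for `q`. -/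
theorem IsReferenceMachine.exists_K_add_condK_le_add_K {U : Str → Str →. Str}
    (hU : IsReferenceMachine U) : ∃ c : ℕ, ∀ x z q, z ∈ U q (shortestProgram U x) →
      K U z + condK U x (shortestProgram U z) ≤ K U x + K U q + c := by
  have hW := hU.exists_K_add_condK_le (W := fun p z x => ∃ s : Str × Str × Str,
      p = s.1 ++ s.2.1 ∧ x ∈ U s.1 [] ∧ s.2.2 ∈ U s.2.1 [] ∧ z ∈ U s.2.2 s.1) ?_ ?_
  · obtain ⟨c, hc⟩ := hW
    refine ⟨c, fun x z q hq => ?_⟩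
    obtain ⟨hx, hlx⟩ := hU.shortestProgram_spec x
    obtain ⟨hq', hlq⟩ := hU.shortestProgram_spec q
    have := hc _ z x ⟨(shortestProgram U x, shortestProgram U q, q), rfl, hx, hq', hq⟩
    rwa [List.length_append, hlx, hlq] at this
  · refine .exists_right (P := fun (a : Str × Str × Str) (s : Str × Str × Str) =>
      a.1 = s.1 ++ s.2.1 ∧ a.2.2 ∈ U s.1 [] ∧ s.2.2 ∈ U s.2.1 [] ∧ a.2.1 ∈ U s.2.2 s.1) ?_
    have e1 : Primrec fun a : (Str × Str × Str) × (Str × Str × Str) => a.2.1 := .comp .fst .snd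
    have e2 : Primrec fun a : (Str × Str × Str) × (Str × Str × Str) => a.2.2.1 :=
      .comp .fst (.comp .snd .snd)
    have e3 : Primrec fun a : (Str × Str × Str) × (Str × Str × Str) => a.2.2.2 :=
      .comp .snd (.comp .snd .snd)
    exact .and (.of_primrecPred (Primrec.eq.comp (.comp .fst .fst)
      (Primrec.list_append.comp e1 e2)))
      (.and (hU.semiDecidable_mem e1 (.const []) (.comp .snd (.comp .snd .fst)))
      (.and (hU.semiDecidable_mem e2 (.const []) e3)
      (hU.semiDecidable_mem e3 e1 (.comp .fst (.comp .snd .fst)))))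
  · rintro p p' z z' x x' ⟨⟨p1, p2, q⟩, rfl, hx, hq, hz⟩ ⟨⟨p1', p2', q'⟩, rfl, hx', hq', hz'⟩ hp
    obtain ⟨rfl, hp⟩ := hU.split_unique hx hx' hp
    obtain ⟨rfl, rfl⟩ := hU.eq_of_prefix hq hq' hp
    exact ⟨rfl, Part.mem_unique hz hz', Part.mem_unique hx hx'⟩

/-! ### Conservation of information -/

theorem IsReferenceMachine.exists_mutualInfo_lt {U : Str → Str →. Str}
    (hU : IsReferenceMachine U) : ∃ c : ℕ, ∀ x y z q, z ∈ U q (shortestProgram U x) →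
      mutualInfo U z y < mutualInfo U x y + K U q + c ∧
      mutualInfo U z y < mutualInfo U x y + q.length + c := by
  obtain ⟨c₁, h₁⟩ := hU.exists_K_add_condK_le_via
  obtain ⟨c₂, h₂⟩ := hU.exists_K_add_condK_le_add_K
  obtain ⟨c₃, h₃⟩ := hU.exists_K_add_condK_le_add_length
  refine ⟨c₁ + c₂ + c₃ + 1, fun x y z q hq => ?_⟩
  have h₁ := h₁ x y z
  have h₂ := h₂ x z q hq
  have h₃ := h₃ x z q hq
  unfold mutualInfo
  omega

theorem IsReferenceMachine.exists_mutualInfo_le_symm {U : Str → Str →. Str}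
    (hU : IsReferenceMachine U) : ∃ c : ℕ, ∀ x y, mutualInfo U x y ≤ mutualInfo U y x + c := by
  obtain ⟨c, h⟩ := hU.exists_K_add_condK_le_add_length
  refine ⟨c, fun x y => ?_⟩
  obtain ⟨q, hq, hlq⟩ := hU.exists_program_length_eq y (shortestProgram U x)
  have := h x y q hq
  unfold mutualInfo
  omega

/-- The value of a partial recursive function `f` at `x` has a program of length at most
`K(f) + O(1)` given `x*`: it runs a shortest program for an index of `f`. -/
theorem IsReferenceMachine.exists_program_of_mem {U : Str → Str →. Str}
    (hU : IsReferenceMachine U) : ∃ c : ℕ, ∀ f : Str →. Str, Partrec f → ∀ x u, u ∈ f x →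
      ∃ q, u ∈ U q (shortestProgram U x) ∧ q.length ≤ funK U f + c := by
  have hphi : Partrec fun a : ℕ × ℕ => phi a.1 a.2 :=
    Nat.Partrec.Code.eval_part.comp ((Computable.ofNat _).comp .fst) .snd
  have hW := hU.exists_condK_le_length (W := fun p y u => ∃ s : Str × Str,
      s.1 ∈ U p [] ∧ s.2 ∈ U y [] ∧ strToNat u ∈ phi (strToNat s.1) (strToNat s.2)) ?_ ?_
  · obtain ⟨c, hc⟩ := hW
    refine ⟨c, fun f hf x u hu => ?_⟩
    obtain ⟨j, hj⟩ := exists_computes hf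
    obtain ⟨i, hi, hK⟩ := Nat.sInf_mem
      (s := {k : ℕ | ∃ i : ℕ, Computes i f ∧ K U (natToStr i) = k}) ⟨_, j, hj, rfl⟩
    change K U (natToStr i) = funK U f at hK
    obtain ⟨hp, hlp⟩ := hU.shortestProgram_spec (natToStr i)
    obtain ⟨hx, -⟩ := hU.shortestProgram_spec x
    have h := hc (shortestProgram U (natToStr i)) (shortestProgram U x) u
      ⟨(natToStr i, x), hp, hx, by rw [strToNat_natToStr, hi x]; exact Part.mem_map _ hu⟩
    obtain ⟨q, hq, hlq⟩ := hU.exists_program_length_eq u (shortestProgram U x)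
    exact ⟨q, hq, by omega⟩
  · refine .exists_right (P := fun (a : (Str × Str) × Str) (s : Str × Str) =>
      s.1 ∈ U a.1.1 [] ∧ s.2 ∈ U a.1.2 [] ∧
        strToNat a.2 ∈ phi (strToNat s.1) (strToNat s.2)) ?_
    have e1 : Primrec fun a : ((Str × Str) × Str) × (Str × Str) => a.2.1 := .comp .fst .snd
    have e2 : Primrec fun a : ((Str × Str) × Str) × (Str × Str) => a.2.2 := .comp .snd .snd
    exact .and (hU.semiDecidable_mem (.comp .fst (.comp .fst .fst)) (.const []) e1)
      (.and (hU.semiDecidable_mem (.comp .snd (.comp .fst .fst)) (.const []) e2)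
      ((SemiDecidable.graph hphi).comp (((primrec_strToNat.comp e1).pair
        (primrec_strToNat.comp e2)).pair (primrec_strToNat.comp (.comp .snd .fst)))))
  · rintro y p p' u u' ⟨⟨i, x⟩, hi, hx, hu⟩ ⟨⟨i', x'⟩, hi', hx', hu'⟩ hp
    obtain ⟨rfl, rfl⟩ := hU.eq_of_prefix hi hi' hp
    obtain rfl := Part.mem_unique hx hx'
    exact ⟨rfl, strToNat_injective (Part.mem_unique hu hu')⟩

end AlgInfo

theorem mainTheorem8 (U : AlgInfo.Str → AlgInfo.Str →. AlgInfo.Str)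
    (hU : AlgInfo.IsReferenceMachine U) :
    (∃ c : ℕ, ∀ x y z q : AlgInfo.Str, z ∈ U q (AlgInfo.shortestProgram U x) →
      AlgInfo.mutualInfo U z y < AlgInfo.mutualInfo U x y + AlgInfo.K U q + c ∧
      AlgInfo.mutualInfo U z y < AlgInfo.mutualInfo U x y + q.length + c) ∧
    (∃ c : ℕ, ∀ f g : AlgInfo.Str →. AlgInfo.Str, Partrec f → Partrec g →
      ∀ x y u v : AlgInfo.Str, u ∈ f x → v ∈ g y →
        AlgInfo.mutualInfo U u v <
          AlgInfo.mutualInfo U x y + AlgInfo.funK U f + AlgInfo.funK U g + c) := by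
  refine ⟨hU.exists_mutualInfo_lt, ?_⟩
  obtain ⟨c₁, h₁⟩ := hU.exists_mutualInfo_lt
  obtain ⟨c₂, h₂⟩ := hU.exists_mutualInfo_le_symm
  obtain ⟨c₃, h₃⟩ := hU.exists_program_of_mem
  refine ⟨2 * c₁ + 2 * c₂ + 2 * c₃, fun f g hf hg x y u v hu hv => ?_⟩
  obtain ⟨p, hp, hlp⟩ := h₃ f hf x u hu
  obtain ⟨q, hq, hlq⟩ := h₃ g hg y v hv
  -- `I(u : v) ≤ I(x : v) ≤ I(v : x) ≤ I(y : x) ≤ I(x : y)`, up to `K(f)`, `K(g)` and constants.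
  have i₁ := (h₁ x v u p hp).2
  have i₂ := h₂ x v
  have i₃ := (h₁ y x v q hq).2
  have i₄ := h₂ y x
  push_cast
  omega
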